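/- Let $T$ be a locally finite tree, and let $G=\operatorname{Aut}(T)$ be its automorphism group, endowed with the topology generated by the sets $U(g,S)=\{h\in G \mid h(x)=g(x)\ \forall x\in S\}$, where $g\in G$ and $S$ is a finite set of vertices; this makes $G$ a locally compact group. Let $d\ge 2$ be an integer. Let $M_d(G)$ be the space of all bounded continuous $\varphi:G\to\mathbb{C}$ for which there are Hilbert spaces $\mathcal{H}_0=\mathbb{C},\mathcal{H}_1,\dots,\mathcal{H}_{d-1},\mathcal{H}_d=\mathbb{C}$ and bounded maps $\xi_i:G\to\mathbf{B}(\mathcal{H}_i,\mathcal{H}_{i-1})$ $(i=1,\dots,d)$ with $$\varphi(t_1\cdots t_d)=\xi_1(t_1)\cdots\xi_d(t_d)1\qquad\text{for all } t_1,\dots,t_d\in G,$$ and let $\|\varphi\|_{M_d(G)}$ be the infimum of $\sup_{t}\|\xi_1(t)\|\cdots\sup_{t}\|\xi_d(t)\|$ over all such decompositions. Let $X_d(G)$ be the completion of $L^1(G)$ (for a left Haar measure) for the norm $\|g\|_{X_d(G)}=\sup\{|\int_G\varphi g|\,:\,\varphi\in M_d(G),\ \|\varphi\|_{M_d(G)}\le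 1\}$, and let $\sigma(M_d(G),X_d(G))$ be the weak topology on $M_d(G)$ given by the continuous extension to $X_d(G)$ of the duality $\langle\varphi,g\rangle=\int_G\varphi g$. Say that $G$ is $M_d$-weakly amenable if there is $C\ge 1$ such that the constant function $1$ is in the $\sigma(M_d(G),X_d(G))$-closure of $\{\varphi\in M_d(G)\cap C_c(G)\mid \|\varphi\|_{M_d(G)}\le C\}$, and let $\boldsymbol\Lambda(G,d)$ be the infimum of all such $C$ ($\infty$ if there is none). Then, for every $d\ge 2$, $G=\operatorname{Aut}(T)$ is $M_d$-weakly amenable with $\boldsymbol\Lambda(G,d)=1$. -/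

import Mathlib

open MeasureTheory Topology
open scoped ENNReal BoundedContinuousFunction

universe u

noncomputable section

/-! ## Multipliers -/

/-- A factorisation `φ (t₁ ⋯ t_d) = ξ₁(t₁) ⋯ ξ_d(t_d) 1` through Hilbert spaces
`ℋ_d → ⋯ → ℋ_1 → ℋ_0`, where `ℋ_0` and `ℋ_d` are identified with `ℂ` by the isometries `e₀`, `e_d`.
The indices are shifted by one: `ξ i` maps `G` to `B(ℋ (i+1), ℋ i)` for `i = 0, …, d - 1`.
The spaces `H i` with `i > d` and the maps `ξ i` with `i ≥ d` play no role. No continuity or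
measurability of the `ξ i` is required. -/
structure MdFactorization (G : Type u) [Group G] (d : ℕ) where
  H : ℕ → Type u
  [normed : ∀ i, NormedAddCommGroup (H i)]
  [inner : ∀ i, InnerProductSpace ℂ (H i)]
  [complete : ∀ i, CompleteSpace (H i)]
  e₀ : ℂ ≃ₗᵢ[ℂ] H 0
  e_d : ℂ ≃ₗᵢ[ℂ] H d
  ξ : ∀ i, G → H (i + 1) →L[ℂ] H i
  bounded : ∀ i < d, BddAbove (Set.range fun t => ‖ξ i t‖)

attribute [instance] MdFactorization.normed MdFactorization.inner MdFactorization.complete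

namespace MdFactorization

variable {G : Type u} [Group G] {d : ℕ}

/-- The operator `ξ₁(t₁) ⋯ ξ_k(t_k) : ℋ_k → ℋ_0`. -/
def chain (D : MdFactorization G d) (t : ℕ → G) : ∀ k, D.H k →L[ℂ] D.H 0
  | 0 => ContinuousLinearMap.id ℂ _
  | k + 1 => (D.chain t k).comp (D.ξ k (t k))

/-- The complex number `ξ₁(t₁) ⋯ ξ_d(t_d) 1`. -/
def eval (D : MdFactorization G d) (t : ℕ → G) : ℂ :=
  D.e₀.symm (D.chain t d (D.e_d 1))

/-- `D` is a factorisation of the function `φ`. -/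
def Represents (D : MdFactorization G d) (φ : G → ℂ) : Prop :=
  ∀ t : ℕ → G, φ ((List.range d).map t).prod = D.eval t

/-- The number `sup ‖ξ₁‖ ⋯ sup ‖ξ_d‖`. -/
def bound (D : MdFactorization G d) : ℝ :=
  ∏ i ∈ Finset.range d, ⨆ t, ‖D.ξ i t‖

lemma iSup_nonneg (D : MdFactorization G d) (i : ℕ) : 0 ≤ ⨆ t, ‖D.ξ i t‖ :=
  Real.iSup_nonneg fun _ => norm_nonneg _

lemma bound_nonneg (D : MdFactorization G d) : 0 ≤ D.bound :=
  Finset.prod_nonneg fun i _ => D.iSup_nonneg i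

lemma norm_chain_le (D : MdFactorization G d) (t : ℕ → G) (k : ℕ) (hk : k ≤ d) :
    ‖D.chain t k‖ ≤ ∏ i ∈ Finset.range k, ⨆ t, ‖D.ξ i t‖ := by
  induction k with
  | zero => simpa [chain] using ContinuousLinearMap.norm_id_le
  | succ k ih =>
    rw [Finset.prod_range_succ]
    refine (ContinuousLinearMap.opNorm_comp_le _ _).trans ?_
    exact mul_le_mul (ih (by omega)) (le_ciSup (D.bounded k (by omega)) (t k)) (norm_nonneg _)
      (Finset.prod_nonneg fun i _ => D.iSup_nonneg i)

lemma norm_eval_le (D : MdFactorization G d) (t : ℕ → G) : ‖D.eval t‖ ≤ D.bound := by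
  have h := (D.chain t d).le_opNorm (D.e_d 1)
  have h1 : ‖D.e_d 1‖ = 1 := by simp
  rw [h1, mul_one] at h
  have h2 : ‖D.eval t‖ = ‖D.chain t d (D.e_d 1)‖ := D.e₀.symm.norm_map _
  exact h2.le.trans (h.trans (D.norm_chain_le t d le_rfl))

lemma Represents.norm_le {D : MdFactorization G d} {φ : G → ℂ} (h : D.Represents φ) (hd : 1 ≤ d)
    (s : G) : ‖φ s‖ ≤ D.bound := by
  have key : ∀ n : ℕ, ((List.range (n + 1)).map (fun i => if i = 0 then s else 1)).prod = s := by
    intro n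
    induction n with
    | zero => simp
    | succ n ih => rw [List.range_succ, List.map_append, List.prod_append, ih]; simp
  obtain ⟨n, rfl⟩ : ∃ n, d = n + 1 := ⟨d - 1, by omega⟩
  have := h fun i => if i = 0 then s else 1
  rw [key] at this
  rw [this]
  exact D.norm_eval_le _

/-- Multiply the first map of a factorisation by a scalar. -/
def smul (c : ℂ) (D : MdFactorization G d) : MdFactorization G d where
  H := D.H
  e₀ := D.e₀
  e_d := D.e_d
  ξ i t := (if i = 0 then c else 1) • D.ξ i t
  bounded i hi := by
    obtain ⟨B, hB⟩ := D.bounded i hi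
    refine ⟨‖(if i = 0 then c else 1 : ℂ)‖ * B, ?_⟩
    rintro _ ⟨t, rfl⟩
    dsimp only
    rw [norm_smul]
    exact mul_le_mul_of_nonneg_left (hB ⟨t, rfl⟩) (norm_nonneg _)

lemma chain_smul (c : ℂ) (D : MdFactorization G d) (t : ℕ → G) (k : ℕ) :
    ((D.smul c).chain t (k + 1) : D.H (k + 1) →L[ℂ] D.H 0) = c • D.chain t (k + 1) := by
  induction k with
  | zero =>
    change (ContinuousLinearMap.id ℂ (D.H 0)).comp ((if 0 = 0 then c else 1) • D.ξ 0 (t 0)) =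
      c • (ContinuousLinearMap.id ℂ (D.H 0)).comp (D.ξ 0 (t 0))
    simp
  | succ k ih =>
    have h1 : ((if k + 1 = 0 then c else 1 : ℂ) • D.ξ (k + 1) (t (k + 1))) =
        D.ξ (k + 1) (t (k + 1)) := by simp
    let A : D.H (k + 1) →L[ℂ] D.H 0 := (D.smul c).chain t (k + 1)
    have hA : A = c • D.chain t (k + 1) := ih
    change A.comp ((if k + 1 = 0 then c else 1 : ℂ) • D.ξ (k + 1) (t (k + 1))) =
      c • (D.chain t (k + 1)).comp (D.ξ (k + 1) (t (k + 1)))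
    rw [h1, hA, ContinuousLinearMap.smul_comp]

lemma Represents.smul {D : MdFactorization G d} {φ : G → ℂ} (h : D.Represents φ) (hd : 1 ≤ d)
    (c : ℂ) : (D.smul c).Represents (fun s => c * φ s) := by
  intro t
  obtain ⟨n, rfl⟩ : ∃ n, d = n + 1 := ⟨d - 1, by omega⟩
  have h1 : (D.smul c).eval t = D.e₀.symm ((c • D.chain t (n + 1)) (D.e_d 1)) :=
    congrArg (fun F : D.H (n + 1) →L[ℂ] D.H 0 => D.e₀.symm (F (D.e_d 1))) (chain_smul c D t n)
  rw [h1]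
  dsimp only
  rw [h t, smul_apply, map_smul, smul_eq_mul]
  rfl

lemma bound_smul (hd : 1 ≤ d) (c : ℂ) (D : MdFactorization G d) :
    (D.smul c).bound = ‖c‖ * D.bound := by
  obtain ⟨n, rfl⟩ : ∃ n, d = n + 1 := ⟨d - 1, by omega⟩
  have h : ∀ i, (⨆ t, ‖(D.smul c).ξ i t‖) = ‖(if i = 0 then c else 1 : ℂ)‖ * ⨆ t, ‖D.ξ i t‖ := by
    intro i
    rw [Real.mul_iSup_of_nonneg (norm_nonneg _)]
    exact iSup_congr fun t => norm_smul (if i = 0 then c else 1 : ℂ) (D.ξ i t)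
  unfold bound
  simp only [h]
  rw [Finset.prod_range_succ', Finset.prod_range_succ']
  simp
  ring

/-- The trivial factorisation, all of whose maps are the identity of a one-dimensional space. -/
def trivial (G : Type u) [Group G] (d : ℕ) {E : Type u} [NormedAddCommGroup E]
    [InnerProductSpace ℂ E] [CompleteSpace E] (e : ℂ ≃ₗᵢ[ℂ] E) : MdFactorization G d where
  H _ := E
  e₀ := e
  e_d := e
  ξ _ _ := ContinuousLinearMap.id ℂ E
  bounded _ _ := ⟨_, by rintro _ ⟨t, rfl⟩; exact le_rfl⟩

lemma trivial_represents (G : Type u) [Group G] (d : ℕ) {E : Type u} [NormedAddCommGroup E]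
    [InnerProductSpace ℂ E] [CompleteSpace E] (e : ℂ ≃ₗᵢ[ℂ] E) :
    (trivial G d e).Represents (fun _ => 1) := by
  intro t
  have h : ∀ k, ((trivial G d e).chain t k : E →L[ℂ] E) = ContinuousLinearMap.id ℂ E := by
    intro k
    induction k with
    | zero => rfl
    | succ k ih =>
      let A : E →L[ℂ] E := (trivial G d e).chain t k
      have hA : A = ContinuousLinearMap.id ℂ E := ih
      change A.comp (ContinuousLinearMap.id ℂ E) = _
      rw [hA, ContinuousLinearMap.comp_id]
  have h1 : (trivial G d e).eval t = e.symm (e 1) :=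
    congrArg (fun F : E →L[ℂ] E => e.symm (F (e 1))) (h d)
  rw [h1, LinearIsometryEquiv.symm_apply_apply]

end MdFactorization

section Multipliers

variable (G : Type u) [Group G] [TopologicalSpace G] (d : ℕ)

/-- The space `M_d(G)` of bounded continuous functions `G → ℂ` that admit a factorisation. -/
structure MdMultiplier : Type u where
  toFun : G →ᵇ ℂ
  exists_factorization : ∃ D : MdFactorization G d, D.Represents toFun

variable {G d}

namespace MdMultiplier

instance : CoeFun (MdMultiplier G d) (fun _ => G → ℂ) := ⟨fun φ => φ.toFun⟩

/-- The norm of `M_d(G)`: the infimum of `sup ‖ξ₁‖ ⋯ sup ‖ξ_d‖` over all factorisations. -/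
def mdNorm (φ : MdMultiplier G d) : ℝ :=
  sInf {b | ∃ D : MdFactorization G d, D.Represents φ ∧ b = D.bound}

/-- The constant function `1`. -/
instance : One (MdMultiplier G d) :=
  ⟨⟨BoundedContinuousFunction.const G 1, _,
    MdFactorization.trivial_represents G d (OrthonormalBasis.singleton PUnit.{u + 1} ℂ).repr⟩⟩

lemma mdNorm_le (φ : MdMultiplier G d) {D : MdFactorization G d} (hD : D.Represents φ) :
    φ.mdNorm ≤ D.bound :=
  csInf_le ⟨0, by rintro _ ⟨E, -, rfl⟩; exact E.bound_nonneg⟩ ⟨D, hD, rfl⟩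

lemma norm_le_mdNorm (hd : 1 ≤ d) (φ : MdMultiplier G d) (s : G) : ‖φ s‖ ≤ φ.mdNorm := by
  obtain ⟨D, hD⟩ := φ.exists_factorization
  refine le_csInf ⟨_, D, hD, rfl⟩ ?_
  rintro _ ⟨E, hE, rfl⟩
  exact hE.norm_le hd s

end MdMultiplier

end Multipliers

/-! ## The predual and the weak topology -/

section Predual

open MeasureTheory.Measure

variable (G : Type u) [Group G] [TopologicalSpace G] [IsTopologicalGroup G]
  [LocallyCompactSpace G] [MeasurableSpace G] [BorelSpace G] (d : ℕ)

/-- The space `L¹(G)` for the left Haar measure, as a complex vector space; it is going to carry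
the norm of `X_d(G)` and not that of `L¹`. The hypothesis `2 ≤ d` ensures that
this norm is finite. -/
def PreXd [d.AtLeastTwo] : Type u := Lp ℂ 1 (haar : Measure G)

lemma one_le_of_atLeastTwo [h : d.AtLeastTwo] : 1 ≤ d := one_le_two.trans h.prop

namespace PreXd

variable [d.AtLeastTwo]

instance : AddCommGroup (PreXd G d) := inferInstanceAs (AddCommGroup (Lp ℂ 1 (haar : Measure G)))
instance : Module ℂ (PreXd G d) := inferInstanceAs (Module ℂ (Lp ℂ 1 (haar : Measure G)))

variable {G d}

/-- The underlying element of `L¹(G)`. -/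
def toL1 (g : PreXd G d) : Lp ℂ 1 (haar : Measure G) := g

/-- The duality `⟨φ, g⟩ = ∫ φ g` between `M_d(G)` and `L¹(G)`. -/
def pair (φ : MdMultiplier G d) (g : PreXd G d) : ℂ :=
  ∫ t, φ t * g.toL1 t ∂(haar : Measure G)

lemma integrable_pair (φ : MdMultiplier G d) (g : PreXd G d) :
    Integrable (fun t => φ t * g.toL1 t) (haar : Measure G) :=
  (L1.integrable_coeFn g.toL1).bdd_mul (c := ‖φ.toFun‖) φ.toFun.continuous.aestronglyMeasurable
    (Filter.Eventually.of_forall fun t => φ.toFun.norm_coe_le_norm t)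

lemma pair_add (φ : MdMultiplier G d) (g h : PreXd G d) :
    pair φ (g + h) = pair φ g + pair φ h := by
  unfold pair
  rw [← integral_add (integrable_pair φ g) (integrable_pair φ h)]
  refine integral_congr_ae ?_
  filter_upwards [Lp.coeFn_add g.toL1 h.toL1] with t ht
  have : (g + h).toL1 t = g.toL1 t + h.toL1 t := ht
  rw [this, mul_add]

lemma pair_smul (φ : MdMultiplier G d) (c : ℂ) (g : PreXd G d) :
    pair φ (c • g) = c * pair φ g := by
  unfold pair
  rw [← integral_const_mul]
  refine integral_congr_ae ?_
  filter_upwards [Lp.coeFn_smul c g.toL1] with t ht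
  have : (c • g).toL1 t = c * g.toL1 t := ht
  rw [this]
  ring

lemma norm_pair_le (φ : MdMultiplier G d) (g : PreXd G d) :
    ‖pair φ g‖ ≤ φ.mdNorm * ‖g.toL1‖ := by
  rw [L1.norm_eq_integral_norm, ← integral_const_mul]
  refine norm_integral_le_of_norm_le ((L1.integrable_coeFn g.toL1).norm.const_mul _)
    (Filter.Eventually.of_forall fun t => ?_)
  rw [norm_mul]
  exact mul_le_mul_of_nonneg_right (φ.norm_le_mdNorm (one_le_of_atLeastTwo d) t) (norm_nonneg _)

variable (G d) in
/-- The unit ball of `M_d(G)`. -/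
abbrev Ball : Type u := {φ : MdMultiplier G d // φ.mdNorm ≤ 1}

lemma bddAbove_pair (g : PreXd G d) : BddAbove (Set.range fun φ : Ball G d => ‖pair φ.1 g‖) := by
  refine ⟨‖g.toL1‖, ?_⟩
  rintro _ ⟨φ, rfl⟩
  exact (norm_pair_le φ.1 g).trans (mul_le_of_le_one_left (norm_nonneg _) φ.2)

variable (G d) in
/-- The norm of `X_d(G)`: `‖g‖ = sup {|∫ φ g| : ‖φ‖_{M_d(G)} ≤ 1}`. -/
def seminorm : Seminorm ℂ (PreXd G d) :=
  Seminorm.of (fun g => ⨆ φ : Ball G d, ‖pair φ.1 g‖)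
    (fun g h => by
      refine Real.iSup_le (fun φ => ?_) (add_nonneg (Real.iSup_nonneg fun _ => norm_nonneg _)
        (Real.iSup_nonneg fun _ => norm_nonneg _))
      rw [pair_add]
      exact (norm_add_le _ _).trans
        (add_le_add (le_ciSup (bddAbove_pair g) φ) (le_ciSup (bddAbove_pair h) φ)))
    (fun c g => by
      rw [Real.mul_iSup_of_nonneg (norm_nonneg _)]
      exact iSup_congr fun φ => by rw [pair_smul, norm_mul])

instance : SeminormedAddCommGroup (PreXd G d) :=
  (seminorm G d).toAddGroupSeminorm.toSeminormedAddCommGroup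

lemma norm_def (g : PreXd G d) : ‖g‖ = ⨆ φ : Ball G d, ‖pair φ.1 g‖ := rfl

instance : NormedSpace ℂ (PreXd G d) where
  norm_smul_le c g := (map_smul_eq_mul (seminorm G d) c g).le

lemma exists_norm_pair_le (φ : MdMultiplier G d) : ∃ C, ∀ g, ‖pair φ g‖ ≤ C * ‖g‖ := by
  obtain ⟨D, hD⟩ := φ.exists_factorization
  have hb : 0 < D.bound + 1 := by linarith [D.bound_nonneg]
  set c : ℂ := ((D.bound + 1 : ℝ) : ℂ)⁻¹ with hc
  have hc0 : ((D.bound + 1 : ℝ) : ℂ) ≠ 0 := by exact_mod_cast hb.ne'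
  have hcn : ‖c‖ = (D.bound + 1)⁻¹ := by
    rw [hc, norm_inv, Complex.norm_real, Real.norm_of_nonneg hb.le]
  let ψ : MdMultiplier G d := ⟨c • φ.toFun, D.smul c, hD.smul (one_le_of_atLeastTwo d) c⟩
  have hψ : ψ.mdNorm ≤ 1 := by
    refine (ψ.mdNorm_le (D := D.smul c) (hD.smul (one_le_of_atLeastTwo d) c)).trans ?_
    rw [MdFactorization.bound_smul (one_le_of_atLeastTwo d), hcn, inv_mul_le_iff₀ hb]
    linarith
  refine ⟨D.bound + 1, fun g => ?_⟩
  have h1 : ‖pair ψ g‖ ≤ ‖g‖ := le_ciSup (bddAbove_pair g) ⟨ψ, hψ⟩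
  have h2 : pair ψ g = c * pair φ g := by
    unfold pair
    rw [← integral_const_mul]
    exact integral_congr_ae (Filter.Eventually.of_forall fun t => mul_assoc c (φ t) (g.toL1 t))
  rw [h2, norm_mul, hcn, inv_mul_le_iff₀ hb] at h1
  exact h1

/-- The continuous linear functional on `L¹(G)`, for the norm of `X_d(G)`, given by `φ`. -/
def functional (φ : MdMultiplier G d) : PreXd G d →L[ℂ] ℂ :=
  LinearMap.mkContinuousOfExistsBound
    { toFun := pair φ
      map_add' := pair_add φ
      map_smul' := pair_smul φ } (exists_norm_pair_le φ)

end PreXd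

variable [d.AtLeastTwo]

/-- The Banach space `X_d(G)`: the completion of `L¹(G)` for the norm above. -/
abbrev Xd : Type u := UniformSpace.Completion (PreXd G d)

variable {G d}

/-- The duality between `M_d(G)` and `X_d(G)`: the continuous extension of `g ↦ ∫ φ g`. -/
def MdMultiplier.duality (φ : MdMultiplier G d) : Xd G d →L[ℂ] ℂ :=
  (PreXd.functional φ).fromCompletion

lemma MdMultiplier.duality_coe (φ : MdMultiplier G d) (g : PreXd G d) :
    φ.duality (g : Xd G d) = ∫ t, φ t * g.toL1 t ∂(haar : Measure G) :=
  ContinuousLinearMap.fromCompletion_apply_coe _ _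

/-- The topology `σ(M_d(G), X_d(G))`. -/
instance : TopologicalSpace (MdMultiplier G d) :=
  TopologicalSpace.induced (fun φ (x : Xd G d) => φ.duality x) Pi.topologicalSpace

end Predual

/-! ## Weak amenability -/

section WeakAmenability

variable (G : Type u) [Group G] [TopologicalSpace G] [IsTopologicalGroup G]
  [LocallyCompactSpace G] [MeasurableSpace G] [BorelSpace G] (d : ℕ) [d.AtLeastTwo]

/-- The constant function `1` is in the `σ(M_d(G), X_d(G))`-closure of the set of all compactly
supported `φ ∈ M_d(G)` with `‖φ‖_{M_d(G)} ≤ C`. -/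
def OneMemMdClosure (C : ℝ) : Prop :=
  (1 : MdMultiplier G d) ∈ closure {φ : MdMultiplier G d | HasCompactSupport φ ∧ φ.mdNorm ≤ C}

/-- `M_d`-weak amenability. -/
def IsMdWeaklyAmenable : Prop :=
  ∃ C : ℝ, 1 ≤ C ∧ OneMemMdClosure G d C

/-- The constant `Λ(G, d) ∈ [1, ∞]`, equal to `∞` if `G` is not `M_d`-weakly amenable. -/
def mdConstant : ℝ≥0∞ :=
  ⨅ (C : ℝ) (_ : 1 ≤ C ∧ OneMemMdClosure G d C), ENNReal.ofReal C

end WeakAmenability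

/-! ## The automorphism group of a graph -/

namespace SimpleGraph

variable {V : Type u} (T : SimpleGraph V)

/-- The set of all automorphisms that agree with `g` on `S`. -/
def autNhd (g : T ≃g T) (S : Finset V) : Set (T ≃g T) :=
  {h | ∀ x ∈ S, h x = g x}

/-- The topology on the automorphism group generated by the sets `U(g, S)`. -/
instance autTopology : TopologicalSpace (T ≃g T) :=
  TopologicalSpace.generateFrom {U | ∃ g S, U = autNhd T g S}

instance : MeasurableSpace (T ≃g T) := borel _
instance : BorelSpace (T ≃g T) := ⟨rfl⟩

variable {T}

lemma isOpen_autNhd (g : T ≃g T) (S : Finset V) : IsOpen (autNhd T g S) :=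
  TopologicalSpace.isOpen_generateFrom_of_mem ⟨g, S, rfl⟩

lemma isOpen_apply_eq (x y : V) : IsOpen {g : T ≃g T | g x = y} := by
  refine isOpen_iff_forall_mem_open.2 fun g hg => ⟨autNhd T g {x}, fun h hh => ?_,
    isOpen_autNhd g _, fun _ _ => rfl⟩
  exact (hh x (by simp)).trans hg

/-- A map into the automorphism group is continuous if all evaluations are locally constant. -/
lemma continuous_aut_of_isOpen {X : Type*} [TopologicalSpace X] {f : X → (T ≃g T)}
    (h : ∀ x y, IsOpen {a | f a x = y}) : Continuous f := by
  refine continuous_generateFrom_iff.2 ?_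
  rintro _ ⟨g, S, rfl⟩
  have : f ⁻¹' autNhd T g S = ⋂ x ∈ S, {a | f a x = g x} := by
    ext a; simp [autNhd]
  rw [this]
  exact isOpen_biInter_finset fun x _ => h x _

instance : IsTopologicalGroup (T ≃g T) where
  continuous_mul := by
    refine continuous_aut_of_isOpen fun x y => ?_
    have : {a : (T ≃g T) × (T ≃g T) | (a.1 * a.2) x = y} =
        ⋃ z, {g : T ≃g T | g z = y} ×ˢ {g : T ≃g T | g x = z} := by
      ext a; simp [RelIso.mul_apply]
    rw [this]
    exact isOpen_iUnion fun z => (isOpen_apply_eq z y).prod (isOpen_apply_eq x z)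
  continuous_inv := by
    refine continuous_aut_of_isOpen fun x y => ?_
    have : {a : T ≃g T | a⁻¹ x = y} = {g : T ≃g T | g y = x} := by
      ext a
      constructor
      · rintro rfl; exact RelIso.apply_inv_self a x
      · rintro rfl; exact RelIso.inv_apply_self a y
    rw [this]
    exact isOpen_apply_eq y x

lemma finite_walk_length [T.LocallyFinite] (x : V) (n : ℕ) :
    {w | ∃ p : T.Walk x w, p.length = n}.Finite := by
  induction n with
  | zero =>
    refine (Set.finite_singleton x).subset ?_
    rintro w ⟨p, hp⟩
    exact (Walk.eq_of_length_eq_zero hp).symm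
  | succ n ih =>
    refine (ih.biUnion fun u _ => (T.neighborSet u).toFinite).subset ?_
    rintro w ⟨p, hp⟩
    have hnil : ¬ p.Nil := by
      intro h; rw [← Walk.length_eq_zero_iff] at h; omega
    refine Set.mem_biUnion (x := p.penultimate) ⟨p.dropLast, ?_⟩ (p.adj_penultimate hnil)
    rw [Walk.length_dropLast]; omega

/-- The stabiliser of a vertex of a connected, locally finite graph is compact. -/
lemma isCompact_stabilizer [T.LocallyFinite] (hT : T.Connected) (x : V) :
    IsCompact {g : T ≃g T | g x = x} := by
  let _ : TopologicalSpace V := ⊥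
  have _ : DiscreteTopology V := ⟨rfl⟩
  have hw : ∀ w, Nonempty (T.Walk x w) := fun w => hT.preconnected x w
  let p : ∀ w, T.Walk x w := fun w => (hw w).some
  let F : V → Set V := fun w => {v | ∃ q : T.Walk x v, q.length = (p w).length}
  let K : Set ((V → V) × (V → V)) := (Set.univ.pi F) ×ˢ (Set.univ.pi F)
  have hK : IsCompact K :=
    (isCompact_univ_pi fun w => (finite_walk_length x _).isCompact).prod
      (isCompact_univ_pi fun w => (finite_walk_length x _).isCompact)
  have ev1 : ∀ w, Continuous fun a : (V → V) × (V → V) => a.1 w := fun w =>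
    (continuous_apply w).comp continuous_fst
  have ev2 : ∀ w, Continuous fun a : (V → V) × (V → V) => a.2 w := fun w =>
    (continuous_apply w).comp continuous_snd
  have op : ∀ (f : (V → V) × (V → V) → V), (∀ y, IsOpen {a | f a = y}) → Continuous f :=
    fun f hf => continuous_discrete_rng.2 fun y => hf y
  have opn : ∀ (f : (V → V) × (V → V) → V), Continuous f → ∀ y, IsOpen {a | f a = y} :=
    fun f hf y => (isOpen_discrete {y}).preimage hf
  let Z : Set ((V → V) × (V → V)) := {a | (∀ w, a.1 (a.2 w) = w) ∧ (∀ w, a.2 (a.1 w) = w) ∧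
    (∀ v w, T.Adj (a.1 v) (a.1 w) ↔ T.Adj v w) ∧ a.1 x = x}
  have c12 : ∀ w, Continuous fun a : (V → V) × (V → V) => a.1 (a.2 w) := fun w => op _ fun y => by
    have : {a : (V → V) × (V → V) | a.1 (a.2 w) = y} = ⋃ z, {a | a.1 z = y} ∩ {a | a.2 w = z} := by
      ext a; simp
    rw [this]
    exact isOpen_iUnion fun z => (opn _ (ev1 z) y).inter (opn _ (ev2 w) z)
  have c21 : ∀ w, Continuous fun a : (V → V) × (V → V) => a.2 (a.1 w) := fun w => op _ fun y => by
    have : {a : (V → V) × (V → V) | a.2 (a.1 w) = y} = ⋃ z, {a | a.2 z = y} ∩ {a | a.1 w = z} := by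
      ext a; simp
    rw [this]
    exact isOpen_iUnion fun z => (opn _ (ev2 z) y).inter (opn _ (ev1 w) z)
  have hZ : IsClosed Z := by
    have : Z = (⋂ w, {a | a.1 (a.2 w) = w}) ∩ ((⋂ w, {a | a.2 (a.1 w) = w}) ∩
        ((⋂ v, ⋂ w, {a | T.Adj (a.1 v) (a.1 w) ↔ T.Adj v w}) ∩ {a | a.1 x = x})) := by
      ext a; simp [Z]
    rw [this]
    refine (isClosed_iInter fun w => isClosed_eq (c12 w) continuous_const).inter
      ((isClosed_iInter fun w => isClosed_eq (c21 w) continuous_const).inter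
      ((isClosed_iInter fun v => isClosed_iInter fun w => ?_).inter
        (isClosed_eq (ev1 x) continuous_const)))
    exact (isClosed_discrete {q : V × V | T.Adj q.1 q.2 ↔ T.Adj v w}).preimage
      ((ev1 v).prodMk (ev1 w))
  have hKZ : IsCompact (K ∩ Z) := hK.inter_right hZ
  let Ψ : (K ∩ Z : Set ((V → V) × (V → V))) → (T ≃g T) := fun a =>
    { toFun := a.1.1
      invFun := a.1.2
      left_inv := a.2.2.2.1
      right_inv := a.2.2.1
      map_rel_iff' := by intro v w; exact a.2.2.2.2.1 v w }
  have hΨ : Continuous Ψ := continuous_aut_of_isOpen fun v y =>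
    (opn _ (ev1 v) y).preimage continuous_subtype_val
  have _ := isCompact_iff_compactSpace.1 hKZ
  have hr : {g : T ≃g T | g x = x} = Set.range Ψ := by
    ext g
    constructor
    · intro hg
      have key : ∀ h : T ≃g T, h x = x → ∀ w, h w ∈ F w := fun h hh w =>
        ⟨((p w).map h.toHom).copy hh rfl, by simp⟩
      have hg' : g.symm x = x := by
        rw [RelIso.symm_apply_eq]; exact (show g x = x from hg).symm
      refine ⟨⟨(g, g.symm), ⟨fun w _ => key g hg w, fun w _ => key g.symm hg' w⟩,
        fun w => g.apply_symm_apply w, fun w => g.symm_apply_apply w,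
        fun v w => g.map_adj_iff, hg⟩, ?_⟩
      ext v; rfl
    · rintro ⟨a, rfl⟩
      exact a.2.2.2.2.2
  rw [hr]
  exact isCompact_range hΨ

/-- The automorphism group of a locally finite tree is locally compact. -/
lemma IsTree.locallyCompactSpace_aut [T.LocallyFinite] (hT : T.IsTree) :
    LocallyCompactSpace (T ≃g T) := by
  obtain ⟨x⟩ := hT.connected.nonempty
  exact (isCompact_stabilizer hT.connected x).locallyCompactSpace_of_mem_nhds_of_group
    ((isOpen_apply_eq x x).mem_nhds (show (1 : T ≃g T) x = x from rfl))

end SimpleGraph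

end

/-! Fix a vertex `o`. Haagerup's functions `g ↦ r ^ d(o, g o)`, `0 ≤ r < 1`, are positive definite,
so their `M_d`-norm is at most `1`, and they tend to `1` pointwise as `r → 1`. They need not have
compact support, so it suffices that discarding the values with `d(o, g o) > N` costs arbitrarily
little in `M_d`-norm. After division by `1 + ε` the truncations lie in the unit ball, where
pointwise convergence of sequences is enough (`MdMultiplier.tendsto_of_tendsto_apply`).

Both estimates come from one construction, `isContractiveCoefficient_of_dist`. For an operator `Z`
on a Hilbert space `K`, the finitely supported functions `V → K` carry a seminorm, depending on the
root `o`, for which `Z ^ d(o, g o)` gives coefficients of the permutation action. Moving the root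
across an edge alters two terms only, and along a geodesic the errors sum to a multiple of the
initial energy (`IsTree.branchEnergy_le`). Hence the action is bounded by `√B` uniformly in `g`.

The scalar `Z = r` allows `B = 1` and yields Haagerup's functions. With `Z = √r · shift` on `ℓ²(ℕ)`,
one has `Z ^ n e₀ = √r ^ n e_n`; pairing with the tail of `(√r ^ n)` produces the tail of `r ^ n`,
with norm at most `√B ^ d` times that of the tail vector, which tends to `0` as `N → ∞`. -/

namespace SimpleGraph

variable {V : Type u} {T : SimpleGraph V}

/-! ### Distances and geodesics in a tree. -/

lemma Iso.dist_apply (g : T ≃g T) (hT : T.Connected) (x y : V) :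
    T.dist (g x) (g y) = T.dist x y := by
  have key : ∀ (h : T ≃g T) (x y : V), T.dist (h x) (h y) ≤ T.dist x y := by
    intro h x y
    obtain ⟨p, hp⟩ := hT.exists_walk_length_eq_dist x y
    rw [← hp, ← Walk.length_map h.toHom p]
    exact dist_le _
  refine le_antisymm (key g x y) ?_
  simpa using key g.symm (g x) (g y)

/-- Both neighbours are the second vertex of a geodesic from `o` to `x`, and paths in a tree are
unique. -/
lemma IsTree.eq_of_adj_of_dist_eq (hT : T.IsTree) {o x y y' : V} (hy : T.Adj o y)
    (hy' : T.Adj o y') (h : T.dist o x = T.dist y x + 1) (h' : T.dist o x = T.dist y' x + 1) :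
    y = y' := by
  obtain ⟨p, hp⟩ := hT.connected.exists_walk_length_eq_dist y x
  obtain ⟨p', hp'⟩ := hT.connected.exists_walk_length_eq_dist y' x
  have hq : (Walk.cons hy p).IsPath := Walk.isPath_of_length_eq_dist _ (by simp [hp, h])
  have hq' : (Walk.cons hy' p').IsPath := Walk.isPath_of_length_eq_dist _ (by simp [hp', h'])
  have := congrArg (fun q : T.Path o x => q.1.snd)
    ((hT.isAcyclic.subsingleton_path o x).elim ⟨_, hq⟩ ⟨_, hq'⟩)
  simpa using this

/-- Moving the root of a tree to a neighbour does not affect which vertices lie beyond a vertex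
different from the root. -/
lemma IsTree.dist_add_dist_of_adj (hT : T.IsTree) {o o' v x : V} (ho : T.Adj o o') (hv : v ≠ o)
    (h : T.dist o v + T.dist v x = T.dist o x) : T.dist o' v + T.dist v x = T.dist o' x := by
  have htri : T.dist o' x ≤ T.dist o' v + T.dist v x := hT.connected.dist_triangle
  have htri2 : T.dist o x ≤ T.dist o o' + T.dist o' x := hT.connected.dist_triangle
  have hoo : T.dist o o' = 1 := dist_eq_one_iff_adj.2 ho
  have h1 := hT.dist_ne_of_adj v ho
  have h2 := hT.dist_ne_of_adj x ho
  have h3 := ho.diff_dist_adj (u := v)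
  have h4 := ho.diff_dist_adj (u := x)
  simp only [dist_comm (u := v) (v := o), dist_comm (u := v) (v := o'), dist_comm (u := x) (v := o),
    dist_comm (u := x) (v := o')] at h1 h2 h3 h4
  by_cases hc : T.dist o v = T.dist o' v + 1
  · omega
  by_cases hx : T.dist o x = T.dist o' x + 1
  -- Here `o'` is closer to `x` than `o` but farther from `v`. The first step `y` of a geodesic from
  -- `o` to `v` also leads towards `x`, so `y = o'`, a contradiction.
  · exfalso
    obtain ⟨p, hp⟩ := hT.connected.exists_walk_length_eq_dist o v
    have hnil : ¬ p.Nil := fun hn => hv hn.eq.symm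
    cases p with
    | nil => exact hnil Walk.Nil.nil
    | cons hadj q =>
      rename_i y
      rw [Walk.length_cons] at hp
      have hq : T.dist y v ≤ q.length := dist_le q
      have hoy : T.dist o y = 1 := dist_eq_one_iff_adj.2 hadj
      have e1 : T.dist o v ≤ T.dist o y + T.dist y v := hT.connected.dist_triangle
      have e2 : T.dist y x ≤ T.dist y v + T.dist v x := hT.connected.dist_triangle
      have e3 : T.dist o x ≤ T.dist o y + T.dist y x := hT.connected.dist_triangle
      have := hT.eq_of_adj_of_dist_eq ho hadj hx (by omega)
      subst this
      omega
  · omega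

/-! ### Branch sums and their energy under a change of root. -/

variable {K : Type*} [NormedAddCommGroup K] [NormedSpace ℂ K]

open Classical in
/-- The vector at `v` obtained by transporting a finitely supported function `f` towards the root
`o` along geodesics, applying `Z` at each step: `∑ Z ^ d(v, x) f(x)`, where `x` ranges over the
vertices such that `v` lies between `o` and `x`. -/
noncomputable def branchSum (T : SimpleGraph V) (Z : K →L[ℂ] K) (o v : V) : (V →₀ K) →ₗ[ℂ] K :=
  Finsupp.lsum ℂ fun x =>
    if T.dist o v + T.dist v x = T.dist o x then ((Z ^ T.dist v x : K →L[ℂ] K) : K →ₗ[ℂ] K) else 0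

open Classical in
lemma branchSum_single (Z : K →L[ℂ] K) (o v x : V) (k : K) :
    branchSum T Z o v (Finsupp.single x k) =
      if T.dist o v + T.dist v x = T.dist o x then (Z ^ T.dist v x) k else 0 := by
  simp only [branchSum, Finsupp.lsum_single]
  split_ifs <;> rfl

lemma branchSum_mapDomain (hT : T.Connected) (Z : K →L[ℂ] K) (g : T ≃g T) (o v : V) (f : V →₀ K) :
    branchSum T Z (g o) (g v) (f.mapDomain g) = branchSum T Z o v f := by
  induction f using Finsupp.induction_linear with
  | zero => simp
  | add f₁ f₂ h₁ h₂ => rw [Finsupp.mapDomain_add, map_add, map_add, h₁, h₂]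
  | single x k =>
    rw [Finsupp.mapDomain_single, branchSum_single, branchSum_single]
    simp only [g.dist_apply hT]

lemma IsTree.branchSum_eq_of_adj (hT : T.IsTree) (Z : K →L[ℂ] K) {o o' v : V} (ho : T.Adj o o')
    (hv : v ≠ o) (hv' : v ≠ o') (f : V →₀ K) : branchSum T Z o v f = branchSum T Z o' v f := by
  induction f using Finsupp.induction_linear with
  | zero => simp
  | add f₁ f₂ h₁ h₂ => rw [map_add, map_add, h₁, h₂]
  | single x k =>
    rw [branchSum_single, branchSum_single]
    congr 1
    exact propext ⟨hT.dist_add_dist_of_adj ho hv, hT.dist_add_dist_of_adj ho.symm hv'⟩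

/-- Removing the edge splits the vertices in two: those on the side of `o` contribute the first
term, and the others reach `o` through `o'`, at the cost of one more `Z`. -/
lemma IsTree.branchSum_root (hT : T.IsTree) (Z : K →L[ℂ] K) {o o' : V} (ho : T.Adj o o')
    (f : V →₀ K) :
    branchSum T Z o o f = branchSum T Z o' o f + Z (branchSum T Z o o' f) := by
  induction f using Finsupp.induction_linear with
  | zero => simp
  | add f₁ f₂ h₁ h₂ => simp only [map_add, h₁, h₂]; abel
  | single x k =>
    have hoo : T.dist o o' = 1 := dist_eq_one_iff_adj.2 ho
    have h2 := hT.dist_ne_of_adj x ho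
    have h4 := ho.diff_dist_adj (u := x)
    simp only [dist_comm (u := x) (v := o), dist_comm (u := x) (v := o')] at h2 h4
    simp only [branchSum_single, dist_self, zero_add, if_true, hoo, dist_comm (u := o') (v := o)]
    by_cases hx : T.dist o x = T.dist o' x + 1
    · rw [if_neg (by omega), if_pos (by omega), zero_add, hx, pow_succ']
      rfl
    · rw [if_pos (by omega), if_neg (by omega), map_zero, add_zero]

lemma finite_support_branchSum [T.LocallyFinite] (hT : T.Connected) (Z : K →L[ℂ] K) (o : V)
    (f : V →₀ K) : {v | branchSum T Z o v f ≠ 0}.Finite := by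
  induction f using Finsupp.induction_linear with
  | zero => simp
  | add f₁ f₂ h₁ h₂ =>
    refine (h₁.union h₂).subset fun v hv => ?_
    by_contra hc
    simp only [Set.mem_union, Set.mem_ofPred_eq, not_or, not_not] at hc
    exact hv (by rw [map_add, hc.1, hc.2, add_zero])
  | single x k =>
    refine ((Set.finite_Iic (T.dist o x)).biUnion fun n _ =>
      finite_walk_length (T := T) o n).subset ?_
    intro v hv
    have h : T.dist o v + T.dist v x = T.dist o x := by
      by_contra hc
      exact hv (by rw [branchSum_single, if_neg hc])
    obtain ⟨p, hp⟩ := hT.exists_walk_length_eq_dist o v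
    exact Set.mem_biUnion (x := p.length) (by rw [Set.mem_Iic]; omega) ⟨p, rfl⟩

open Classical in
/-- The squared norm of the family of all `branchSum`s, with weight `A` at the root. -/
noncomputable def branchEnergy (T : SimpleGraph V) (Z : K →L[ℂ] K) (A : ℝ) (o : V) (f : V →₀ K) : ℝ :=
  ∑' v, (if v = o then A else 1) * ‖branchSum T Z o v f‖ ^ 2

open Classical in
lemma summable_branchEnergy [T.LocallyFinite] (hT : T.Connected) (Z : K →L[ℂ] K) (A : ℝ) (o : V)
    (f : V →₀ K) : Summable fun v => (if v = o then A else 1) * ‖branchSum T Z o v f‖ ^ 2 := by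
  refine summable_of_hasFiniteSupport
    ((finite_support_branchSum hT Z o f).subset fun v hv hc => hv ?_)
  simp [hc]

lemma branchEnergy_mapDomain (hT : T.Connected) (Z : K →L[ℂ] K) (A : ℝ) (g : T ≃g T) (o : V)
    (f : V →₀ K) : branchEnergy T Z A (g o) (f.mapDomain g) = branchEnergy T Z A o f := by
  unfold branchEnergy
  rw [← g.toEquiv.tsum_eq]
  refine tsum_congr fun v => ?_
  have h : g.toEquiv v = g o ↔ v = o := g.injective.eq_iff
  rw [show branchSum T Z (g o) (g.toEquiv v) (f.mapDomain g) = branchSum T Z o v f from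
    branchSum_mapDomain hT Z g o v f]
  by_cases hv : v = o
  · rw [if_pos hv, if_pos (h.2 hv)]
  · rw [if_neg hv, if_neg (mt h.1 hv)]

/-- Only the terms at `o` and `o'` change. With `a`, `b` the sums over the two sides of the edge,
the sums at the old and the new root are `a + Z b` and `b + Z a`, which explains the form of `hAB`.
-/
lemma IsTree.branchEnergy_le_of_adj [T.LocallyFinite] (hT : T.IsTree) (Z : K →L[ℂ] K) {A B : ℝ}
    (hAB : ∀ a b : K, ‖a‖ ^ 2 + A * ‖b + Z a‖ ^ 2 ≤ A * ‖a + Z b‖ ^ 2 + B * ‖b‖ ^ 2)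
    {o o' : V} (ho : T.Adj o o') (f : V →₀ K) :
    branchEnergy T Z A o' f ≤
      branchEnergy T Z A o f + (B - 1) * ‖branchSum T Z o o' f‖ ^ 2 := by
  classical
  have hs := summable_branchEnergy hT.connected Z A o f
  have hs' := summable_branchEnergy hT.connected Z A o' f
  have key : branchEnergy T Z A o' f - branchEnergy T Z A o f =
      (‖branchSum T Z o' o f‖ ^ 2 - A * ‖branchSum T Z o o f‖ ^ 2) +
      (A * ‖branchSum T Z o' o' f‖ ^ 2 - ‖branchSum T Z o o' f‖ ^ 2) := by
    unfold branchEnergy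
    rw [← hs'.tsum_sub hs, tsum_eq_sum (s := {o, o'}), Finset.sum_pair ho.ne]
    · simp [ho.ne, ho.ne.symm]
    · intro v hv
      simp only [Finset.mem_insert, Finset.mem_singleton, not_or] at hv
      rw [hT.branchSum_eq_of_adj Z ho hv.1 hv.2, if_neg hv.1, if_neg hv.2, sub_self]
  have := hAB (branchSum T Z o' o f) (branchSum T Z o o' f)
  rw [← hT.branchSum_root Z ho f, ← hT.branchSum_root Z ho.symm f] at this
  linarith

/-- Each step adds an error at the vertex it enters. A branch sum further along the path is
unaffected by the earlier moves, so every error refers to the initial root, and the factors `B` do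
not multiply. -/
lemma IsTree.branchEnergy_le_of_path [T.LocallyFinite] (hT : T.IsTree) (Z : K →L[ℂ] K) {A B : ℝ}
    (hAB : ∀ a b : K, ‖a‖ ^ 2 + A * ‖b + Z a‖ ^ 2 ≤ A * ‖a + Z b‖ ^ 2 + B * ‖b‖ ^ 2)
    {o o' : V} (p : T.Walk o o') (hp : p.IsPath) (f : V →₀ K) :
    branchEnergy T Z A o' f ≤ branchEnergy T Z A o f +
      (B - 1) * (p.support.tail.map fun v => ‖branchSum T Z o v f‖ ^ 2).sum := by
  induction p with
  | nil => simp
  | @cons o o₁ o' ho p ih =>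
    rw [Walk.cons_isPath_iff] at hp
    have h1 := ih hp.1
    have h2 := hT.branchEnergy_le_of_adj Z hAB ho f
    have h3 : (p.support.tail.map fun v => ‖branchSum T Z o₁ v f‖ ^ 2) =
        p.support.tail.map fun v => ‖branchSum T Z o v f‖ ^ 2 := by
      refine List.map_congr_left fun v hv => ?_
      have hv1 : v ≠ o₁ := by
        rintro rfl
        have := hp.1.support_nodup
        rw [← Walk.cons_tail_support] at this
        exact (List.nodup_cons.1 this).1 hv
      have hv2 : v ≠ o := by
        rintro rfl
        exact hp.2 (List.mem_of_mem_tail hv)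
      rw [hT.branchSum_eq_of_adj Z ho hv2 hv1]
    rw [h3] at h1
    rw [Walk.support_cons, List.tail_cons, ← Walk.cons_tail_support p, List.map_cons, List.sum_cons]
    linarith

/-- Changing the root changes the energy by a bounded factor. -/
lemma IsTree.branchEnergy_le [T.LocallyFinite] (hT : T.IsTree) (Z : K →L[ℂ] K) {A B : ℝ}
    (hA : 0 ≤ A) (hB : 1 ≤ B)
    (hAB : ∀ a b : K, ‖a‖ ^ 2 + A * ‖b + Z a‖ ^ 2 ≤ A * ‖a + Z b‖ ^ 2 + B * ‖b‖ ^ 2)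
    (o o' : V) (f : V →₀ K) :
    branchEnergy T Z A o' f ≤ B * branchEnergy T Z A o f := by
  classical
  obtain ⟨p, hp, -⟩ := hT.connected.exists_path_of_dist o o'
  have h1 := hT.branchEnergy_le_of_path Z hAB p hp f
  have hnd := hp.support_nodup
  rw [← Walk.cons_tail_support, List.nodup_cons] at hnd
  -- The vertices of the path after `o` are distinct and have weight `1`, so the errors form part of
  -- the energy itself.
  have h2 : (p.support.tail.map fun v => ‖branchSum T Z o v f‖ ^ 2).sum ≤
      branchEnergy T Z A o f := by
    rw [← List.sum_toFinset _ hnd.2]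
    refine le_trans (Finset.sum_le_sum fun v hv => ?_)
      ((summable_branchEnergy hT.connected Z A o f).sum_le_tsum p.support.tail.toFinset
        fun v _ => by positivity)
    rw [if_neg, one_mul]
    rintro rfl
    exact hnd.1 (List.mem_toFinset.1 hv)
  nlinarith

end SimpleGraph

/-! ### From products of contractions to factorisations. -/

namespace MdFactorization

variable {G : Type u} [Group G]

section OfContractions

variable {E : Type u} [NormedAddCommGroup E] [InnerProductSpace ℂ E]

/-- The line through `b`, the whole space `d - 1` times, and the line through `a`. -/
def stage (d : ℕ) (a b : E) (i : ℕ) : Submodule ℂ E :=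
  if i = 0 then ℂ ∙ b else if i = d then ℂ ∙ a else ⊤

lemma stage_zero (d : ℕ) (a b : E) : stage d a b 0 = ℂ ∙ b := if_pos rfl

lemma stage_last {d : ℕ} (hd : 1 ≤ d) (a b : E) : stage d a b d = ℂ ∙ a := by
  rw [stage, if_neg (by omega), if_pos rfl]

lemma stage_middle {d i : ℕ} (hi : 0 < i) (hid : i < d) (a b : E) : stage d a b i = ⊤ := by
  rw [stage, if_neg (by omega), if_neg (by omega)]

lemma norm_compression_le (K L : Submodule ℂ E) [K.HasOrthogonalProjection] {A : E →L[ℂ] E}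
    (hA : ‖A‖ ≤ 1) : ‖K.orthogonalProjectionOnto ∘L A ∘L L.subtypeL‖ ≤ 1 := by
  have h1 := ContinuousLinearMap.opNorm_comp_le K.orthogonalProjectionOnto (A ∘L L.subtypeL)
  have h2 := ContinuousLinearMap.opNorm_comp_le A L.subtypeL
  have h3 := K.orthogonalProjectionOnto_norm_le
  have h4 := L.norm_subtypeL_le
  exact h1.trans (mul_le_one₀ h3 (norm_nonneg _) (h2.trans (mul_le_one₀ hA (norm_nonneg _) h4)))

/-- A line is isometric to `ℂ`. -/
noncomputable def lineEquiv {K : Submodule ℂ E} {b : E} (hb : ‖b‖ = 1) (hK : K = ℂ ∙ b) :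
    ℂ ≃ₗᵢ[ℂ] K :=
  (LinearIsometryEquiv.toSpanUnitSingleton b hb).trans (LinearIsometryEquiv.ofEq _ _ hK.symm)

lemma coe_lineEquiv {K : Submodule ℂ E} {b : E} (hb : ‖b‖ = 1) (hK : K = ℂ ∙ b) (c : ℂ) :
    (lineEquiv hb hK c : E) = c • b := by
  simp [lineEquiv]

lemma lineEquiv_symm_orthogonalProjection {K : Submodule ℂ E} [K.HasOrthogonalProjection] {b : E}
    (hb : ‖b‖ = 1) (hK : K = ℂ ∙ b) (z : E) :
    (lineEquiv hb hK).symm (K.orthogonalProjectionOnto z) = Inner.inner ℂ b z := by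
  rw [LinearIsometryEquiv.symm_apply_eq]
  refine Subtype.ext ?_
  rw [coe_lineEquiv, Submodule.coe_orthogonalProjectionOnto_apply]
  subst hK
  exact Submodule.starProjection_unit_singleton ℂ hb _

variable [CompleteSpace E]

instance completeSpace_stage (d : ℕ) (a b : E) (i : ℕ) : CompleteSpace (stage d a b i) := by
  have key : ∀ K : Submodule ℂ E, stage d a b i = K → CompleteSpace K →
      CompleteSpace (stage d a b i) := by
    rintro _ rfl h
    exact h
  by_cases h0 : i = 0
  · exact key _ (if_pos h0) inferInstance
  · by_cases hd : i = d
    · exact key _ ((if_neg h0).trans (if_pos hd)) inferInstance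
    · exact key _ ((if_neg h0).trans (if_neg hd))
        (isClosed_univ : IsClosed ((⊤ : Submodule ℂ E) : Set E)).completeSpace_coe

/-- The factorisation given by a coefficient of the products of a family of contractions. -/
noncomputable def ofContractions {d : ℕ} (hd : 1 ≤ d) (σ : G → E →L[ℂ] E) (hσ : ∀ t, ‖σ t‖ ≤ 1)
    {a b : E} (ha : ‖a‖ = 1) (hb : ‖b‖ = 1) : MdFactorization G d where
  H i := stage d a b i
  e₀ := lineEquiv hb (stage_zero d a b)
  e_d := lineEquiv ha (stage_last hd a b)
  ξ i t := (stage d a b i).orthogonalProjectionOnto ∘L σ t ∘L (stage d a b (i + 1)).subtypeL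
  bounded i _ :=
    ⟨1, by rintro _ ⟨t, rfl⟩; exact norm_compression_le (stage d a b i) (stage d a b (i + 1)) (hσ t)⟩

variable {d : ℕ} (hd : 1 ≤ d) (σ : G → E →L[ℂ] E) (hσ : ∀ t, ‖σ t‖ ≤ 1)
    {a b : E} (ha : ‖a‖ = 1) (hb : ‖b‖ = 1)

lemma bound_ofContractions : (ofContractions hd σ hσ ha hb).bound ≤ 1 := by
  refine Finset.prod_le_one (fun i _ => iSup_nonneg _ i) fun i _ => ciSup_le fun t =>
    norm_compression_le (stage d a b i) (stage d a b (i + 1)) (hσ t)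

/-- The intermediate stages are the whole space, so their projections are the identity and only the
projection onto the line through `b` survives. -/
lemma chain_ofContractions (t : ℕ → G) (k : ℕ) (hk : k < d) (z : E) :
    (ofContractions hd σ hσ ha hb).chain t k ((stage d a b k).orthogonalProjectionOnto z) =
      (stage d a b 0).orthogonalProjectionOnto (((List.range k).map fun i => σ (t i)).prod z) := by
  induction k generalizing z with
  | zero => rfl
  | succ k ih =>
    have h1 : ((stage d a b (k + 1)).orthogonalProjectionOnto z : E) = z := by
      rw [Submodule.coe_orthogonalProjectionOnto_apply, Submodule.starProjection_eq_self_iff,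
        stage_middle (by omega) hk]
      trivial
    rw [List.range_succ, List.map_append, List.prod_append]
    simp only [List.map_cons, List.map_nil, List.prod_cons, List.prod_nil, mul_one]
    refine (ih (by omega) (σ (t k) ((stage d a b (k + 1)).orthogonalProjectionOnto z))).trans ?_
    rw [h1]
    rfl

lemma eval_ofContractions (t : ℕ → G) :
    (ofContractions hd σ hσ ha hb).eval t =
      Inner.inner ℂ b (((List.range d).map fun i => σ (t i)).prod a) := by
  obtain ⟨n, rfl⟩ : ∃ n, d = n + 1 := ⟨d - 1, by omega⟩
  have h2 : (ofContractions hd σ hσ ha hb).chain t (n + 1) (lineEquiv ha (stage_last hd a b) 1) =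
      (stage (n + 1) a b 0).orthogonalProjectionOnto
        (((List.range (n + 1)).map fun i => σ (t i)).prod a) := by
    rw [List.range_succ, List.map_append, List.prod_append]
    simp only [List.map_cons, List.map_nil, List.prod_cons, List.prod_nil, mul_one]
    refine (chain_ofContractions hd σ hσ ha hb t n (by omega)
      (σ (t n) (lineEquiv ha (stage_last hd a b) 1 : E))).trans ?_
    rw [coe_lineEquiv, one_smul]
    rfl
  exact (congrArg (lineEquiv hb (stage_zero (n + 1) a b)).symm h2).trans
    (lineEquiv_symm_orthogonalProjection hb _ _)

end OfContractions

end MdFactorization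

/-- `φ (t₁ ⋯ t_d) = ⟪b, σ(t₁) ⋯ σ(t_d) a⟫` for a family `σ` of contractions of a Hilbert space and
vectors `a`, `b` with `‖a‖² ≤ c` and `‖b‖² ≤ c`. -/
def IsContractiveCoefficient {G : Type u} [Group G] (d : ℕ) (c : ℝ) (φ : G → ℂ) : Prop :=
  ∃ (E : Type u) (_ : NormedAddCommGroup E) (_ : InnerProductSpace ℂ E) (_ : CompleteSpace E)
    (σ : G → E →L[ℂ] E) (a b : E), (∀ t, ‖σ t‖ ≤ 1) ∧ ‖a‖ ^ 2 ≤ c ∧ ‖b‖ ^ 2 ≤ c ∧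
      ∀ t : ℕ → G, φ ((List.range d).map t).prod =
        inner ℂ b (((List.range d).map fun i => σ (t i)).prod a)

namespace IsContractiveCoefficient

variable {G : Type u} [Group G] {d : ℕ} {c c' : ℝ} {φ ψ : G → ℂ}

lemma nonneg (h : IsContractiveCoefficient d c φ) : 0 ≤ c := by
  obtain ⟨E, _, _, _, σ, a, b, -, ha, -⟩ := h
  exact (sq_nonneg _).trans ha

lemma list_prod_prodMap {R : Type*} [NormedField R] {E F : Type*} [NormedAddCommGroup E]
    [NormedSpace R E] [NormedAddCommGroup F] [NormedSpace R F]
    (e : WithLp 2 (E × F) ≃L[R] E × F) (l : List ((E →L[R] E) × (F →L[R] F)))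
    (x : E × F) :
    (l.map fun p => (e.symm : E × F →L[R] _) ∘L (p.1.prodMap p.2) ∘L
      (e : WithLp 2 (E × F) →L[R] E × F)).prod (e.symm x) =
      e.symm ((l.map Prod.fst).prod x.1, (l.map Prod.snd).prod x.2) := by
  induction l with
  | nil => simp
  | cons p l ih => simp [ih]

/-- Direct sum of the two families: squared norms of the vectors add, which is why squares are
bounded by `c`. -/
lemma add (h : IsContractiveCoefficient d c φ) (h' : IsContractiveCoefficient d c' ψ) :
    IsContractiveCoefficient d (c + c') (φ + ψ) := by
  obtain ⟨E, _, _, _, σ, a, b, hσ, ha, hb, hφ⟩ := h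
  obtain ⟨F, _, _, _, τ, a', b', hτ, ha', hb', hψ⟩ := h'
  let e := WithLp.prodContinuousLinearEquiv 2 ℂ E F
  refine ⟨WithLp 2 (E × F), inferInstance, inferInstance, inferInstance,
    fun t => (e.symm : E × F →L[ℂ] _) ∘L ((σ t).prodMap (τ t)) ∘L
      (e : WithLp 2 (E × F) →L[ℂ] E × F), e.symm (a, a'), e.symm (b, b'), fun t => ?_, ?_, ?_,
      fun t => ?_⟩
  · refine ContinuousLinearMap.opNorm_le_bound _ zero_le_one fun x => ?_
    rw [one_mul, ← sq_le_sq₀ (norm_nonneg _) (norm_nonneg _), WithLp.prod_norm_sq_eq_of_L2,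
      WithLp.prod_norm_sq_eq_of_L2]
    exact add_le_add
      (pow_le_pow_left₀ (norm_nonneg _) (((σ t).le_of_opNorm_le (hσ t) _).trans_eq (one_mul _)) 2)
      (pow_le_pow_left₀ (norm_nonneg _) (((τ t).le_of_opNorm_le (hτ t) _).trans_eq (one_mul _)) 2)
  · rw [WithLp.prod_norm_sq_eq_of_L2]
    exact add_le_add ha ha'
  · rw [WithLp.prod_norm_sq_eq_of_L2]
    exact add_le_add hb hb'
  · have := list_prod_prodMap e ((List.range d).map fun i => (σ (t i), τ (t i))) (a, a')
    simp only [List.map_map, Function.comp_def] at this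
    rw [this, WithLp.prod_inner_apply, Pi.add_apply, hφ, hψ]
    rfl

lemma exists_factorization (hd : 1 ≤ d) (h : IsContractiveCoefficient d c φ) :
    ∃ D : MdFactorization G d, D.Represents φ ∧ D.bound ≤ c := by
  have hc := h.nonneg
  obtain ⟨E, _, _, _, σ, a, b, hσ, ha, hb, hφ⟩ := h
  -- The lines at both ends need unit vectors; if `a` or `b` vanishes, then `φ = 0`.
  by_cases h0 : a = 0 ∨ b = 0
  · refine ⟨(MdFactorization.trivial G d
      (OrthonormalBasis.singleton PUnit.{u + 1} ℂ).repr).smul 0, ?_, ?_⟩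
    · convert (MdFactorization.trivial_represents G d
        (OrthonormalBasis.singleton PUnit.{u + 1} ℂ).repr).smul hd 0 using 1
      ext s
      obtain ⟨n, rfl⟩ : ∃ n, d = n + 1 := ⟨d - 1, by omega⟩
      have h1 := hφ fun i => if i = 0 then s else 1
      have h2 : ((List.range (n + 1)).map fun i => if i = 0 then s else 1).prod = s := by
        rw [List.range_succ_eq_map, List.map_cons, List.prod_cons, List.map_map,
          List.prod_eq_one, if_pos rfl, mul_one]
        simp
      rw [h2] at h1
      rw [h1, zero_mul]
      rcases h0 with rfl | rfl <;> simp
    · rw [MdFactorization.bound_smul hd, norm_zero, zero_mul]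
      exact hc
  · push Not at h0
    have ha0 : (‖a‖ : ℂ) ≠ 0 := by simpa using h0.1
    have hb0 : (‖b‖ : ℂ) ≠ 0 := by simpa using h0.2
    have ha1 : ‖(‖a‖ : ℂ)⁻¹ • a‖ = 1 := norm_smul_inv_norm h0.1
    have hb1 : ‖(‖b‖ : ℂ)⁻¹ • b‖ = 1 := norm_smul_inv_norm h0.2
    refine ⟨(MdFactorization.ofContractions hd σ hσ ha1 hb1).smul (‖a‖ * ‖b‖ : ℂ), ?_, ?_⟩
    · have hr : (MdFactorization.ofContractions hd σ hσ ha1 hb1).Represents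
          fun s => (‖a‖ * ‖b‖ : ℂ)⁻¹ * φ s := by
        intro t
        dsimp only
        rw [MdFactorization.eval_ofContractions, hφ, inner_smul_left, map_smul, inner_smul_right]
        simp only [map_inv₀, Complex.conj_ofReal, mul_inv]
        ring
      convert hr.smul hd (‖a‖ * ‖b‖ : ℂ) using 2 with s
      field_simp
    · rw [MdFactorization.bound_smul hd]
      have h1 : ‖(‖a‖ * ‖b‖ : ℂ)‖ = ‖a‖ * ‖b‖ := by simp
      rw [h1]
      have h2 := MdFactorization.bound_ofContractions hd σ hσ ha1 hb1
      have h3 : ‖a‖ * ‖b‖ ≤ c := by nlinarith [sq_nonneg (‖a‖ - ‖b‖)]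
      exact (mul_le_of_le_one_right (by positivity) h2).trans h3

end IsContractiveCoefficient

/-! ### Convergence on the unit ball of `M_d(G)`. -/

section WeakTopology

variable {G : Type u} [Group G] [TopologicalSpace G] {d : ℕ}

lemma MdMultiplier.mdNorm_one_le : (1 : MdMultiplier G d).mdNorm ≤ 1 := by
  refine ((1 : MdMultiplier G d).mdNorm_le (MdFactorization.trivial_represents G d
    (OrthonormalBasis.singleton PUnit.{u + 1} ℂ).repr)).trans ?_
  exact Finset.prod_le_one (fun i _ => MdFactorization.iSup_nonneg _ i) fun i _ =>
    ciSup_le fun t => ContinuousLinearMap.norm_id_le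

variable [IsTopologicalGroup G] [LocallyCompactSpace G] [MeasurableSpace G] [BorelSpace G]
  [d.AtLeastTwo]

lemma MdMultiplier.norm_duality_le {φ : MdMultiplier G d} (hφ : φ.mdNorm ≤ 1) (x : Xd G d) :
    ‖φ.duality x‖ ≤ ‖x‖ := by
  induction x using UniformSpace.Completion.induction_on with
  | hp => exact isClosed_le (by fun_prop) continuous_norm
  | ih g =>
    rw [φ.duality_coe, UniformSpace.Completion.norm_coe]
    exact le_ciSup (PreXd.bddAbove_pair g) ⟨φ, hφ⟩

open Filter in
/-- On the unit ball of `M_d(G)`, pointwise convergence of sequences implies convergence for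
`σ(M_d(G), X_d(G))`. -/
lemma MdMultiplier.tendsto_of_tendsto_apply {φ : ℕ → MdMultiplier G d} {ψ : MdMultiplier G d}
    (hφ : ∀ n, (φ n).mdNorm ≤ 1) (hψ : ψ.mdNorm ≤ 1)
    (h : ∀ s, Tendsto (fun n => φ n s) atTop (𝓝 (ψ s))) : Tendsto φ atTop (𝓝 ψ) := by
  have hd : 1 ≤ d := one_le_of_atLeastTwo d
  rw [nhds_induced, tendsto_comap_iff]
  refine tendsto_pi_nhds.2 fun x => ?_
  -- Dominated convergence on `L¹(G)`; density and the uniform bound of the functionals then give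
  -- all of `X_d(G)`.
  have hL1 : ∀ g : PreXd G d, Tendsto (fun n => (φ n).duality (g : Xd G d)) atTop
      (𝓝 (ψ.duality (g : Xd G d))) := by
    intro g
    simp only [MdMultiplier.duality_coe]
    refine tendsto_integral_of_dominated_convergence (fun t => ‖g.toL1 t‖)
      (fun n => (PreXd.integrable_pair (φ n) g).aestronglyMeasurable)
      (L1.integrable_coeFn g.toL1).norm
      (fun n => Eventually.of_forall fun t => ?_) (Eventually.of_forall fun t => (h t).mul_const _)
    rw [norm_mul]
    exact mul_le_of_le_one_left (norm_nonneg _) (((φ n).norm_le_mdNorm hd t).trans (hφ n))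
  rw [Metric.tendsto_atTop]
  intro ε hε
  obtain ⟨g, hg⟩ := UniformSpace.Completion.denseRange_coe.exists_dist_lt x
    (show 0 < ε / 3 by positivity)
  rw [dist_eq_norm] at hg
  obtain ⟨N, hN⟩ := Metric.tendsto_atTop.1 (hL1 g) (ε / 3) (by positivity)
  refine ⟨N, fun n hn => ?_⟩
  have h1 := hN n hn
  have h2 := (MdMultiplier.norm_duality_le (hφ n) (x - g)).trans_lt hg
  have h3 := (MdMultiplier.norm_duality_le hψ (x - g)).trans_lt hg
  rw [dist_eq_norm] at h1 ⊢
  rw [map_sub] at h2 h3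
  calc ‖(φ n).duality x - ψ.duality x‖
      = ‖((φ n).duality x - (φ n).duality g) + ((φ n).duality g - ψ.duality g) -
          (ψ.duality x - ψ.duality g)‖ := by congr 1; ring
    _ ≤ ‖(φ n).duality x - (φ n).duality g‖ + ‖(φ n).duality g - ψ.duality g‖ +
          ‖ψ.duality x - ψ.duality g‖ := (norm_sub_le _ _).trans (by gcongr; exact norm_add_le _ _)
    _ < ε := by linarith

lemma oneMemMdClosure_one_of_tendsto {φ : ℕ → MdMultiplier G d}
    (hφ : ∀ n, (φ n).mdNorm ≤ 1) (hc : ∀ n, HasCompactSupport (φ n))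
    (h : ∀ s, Filter.Tendsto (fun n => φ n s) Filter.atTop (𝓝 1)) : OneMemMdClosure G d 1 :=
  mem_closure_of_tendsto
    (MdMultiplier.tendsto_of_tendsto_apply hφ MdMultiplier.mdNorm_one_le h)
    (Filter.Eventually.of_forall fun n => ⟨hc n, hφ n⟩)

lemma mdConstant_eq_one (h : OneMemMdClosure G d 1) : mdConstant G d = 1 := by
  refine le_antisymm ((iInf₂_le (1 : ℝ) ⟨le_rfl, h⟩).trans_eq ENNReal.ofReal_one)
    (le_iInf₂ fun C hC => ?_)
  rw [← ENNReal.ofReal_one]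
  exact ENNReal.ofReal_le_ofReal hC.1

end WeakTopology

/-! ### The uniformly bounded action on branch sums. -/

namespace SimpleGraph

variable {V : Type u} {T : SimpleGraph V}

section BranchMap

variable {K : Type} [NormedAddCommGroup K] [NormedSpace ℂ K]

open Classical in
lemma memℓp_branchSum [T.LocallyFinite] (hT : T.Connected) (Z : K →L[ℂ] K) (κ : ℂ) (o : V)
    (f : V →₀ K) :
    Memℓp (fun v => (if v = o then κ else 1) • branchSum T Z o v f) 2 := by
  refine Memℓp.of_exponent_ge
    (memℓp_zero ((finite_support_branchSum hT Z o f).subset fun v hv hc => hv ?_)) zero_le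
  simp only [hc, smul_zero]

open Classical in
/-- The family of all `branchSum`s, with weight `κ` at the root, as an element of `ℓ²(V, K)`. -/
noncomputable def branchMap [T.LocallyFinite] (hT : T.Connected) (Z : K →L[ℂ] K) (κ : ℂ) (o : V) :
    (V →₀ K) →ₗ[ℂ] lp (fun _ : V => K) 2 where
  toFun f := ⟨fun v => (if v = o then κ else 1) • branchSum T Z o v f,
    memℓp_branchSum hT Z κ o f⟩
  map_add' f g := by
    ext v
    simp only [lp.coeFn_add, Pi.add_apply, map_add, smul_add]
  map_smul' c f := by
    ext v
    simp only [lp.coeFn_smul, Pi.smul_apply, map_smul, RingHom.id_apply]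
    rw [smul_comm]

open Classical in
lemma branchMap_apply [T.LocallyFinite] (hT : T.Connected) (Z : K →L[ℂ] K) (κ : ℂ) (o v : V)
    (f : V →₀ K) :
    branchMap hT Z κ o f v = (if v = o then κ else 1) • branchSum T Z o v f := rfl

lemma norm_branchMap_sq [T.LocallyFinite] (hT : T.Connected) (Z : K →L[ℂ] K) (κ : ℂ) (o : V)
    (f : V →₀ K) : ‖branchMap hT Z κ o f‖ ^ 2 = branchEnergy T Z (‖κ‖ ^ 2) o f := by
  have := lp.norm_rpow_eq_tsum (p := 2) (by simp) (branchMap hT Z κ o f)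
  simp only [ENNReal.toReal_ofNat, Real.rpow_ofNat] at this
  rw [this]
  refine tsum_congr fun v => ?_
  rw [branchMap_apply, norm_smul, mul_pow]
  split_ifs <;> simp

lemma branchMap_single_root [T.LocallyFinite] [DecidableEq V] (hT : T.Connected) (Z : K →L[ℂ] K)
    (κ : ℂ) (o : V) (k : K) :
    branchMap hT Z κ o (Finsupp.single o k) = lp.single 2 o (κ • k) := by
  ext v
  rw [branchMap_apply, branchSum_single]
  by_cases hv : v = o
  · subst hv
    simp
  · rw [lp.single_apply_ne _ _ _ hv, if_neg hv, if_neg, smul_zero]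
    have := hT.pos_dist_of_ne hv
    rw [dist_self]
    omega

end BranchMap

end SimpleGraph

/-- A linear map that is bounded for the seminorm `‖Φ ·‖` induces a bounded operator. -/
lemma LinearMap.exists_clm_of_norm_le {X E : Type*} [AddCommGroup X] [Module ℂ X]
    [NormedAddCommGroup E] [InnerProductSpace ℂ E] [CompleteSpace E] (Φ : X →ₗ[ℂ] E)
    (ρ : X →ₗ[ℂ] X) {C : ℝ} (hC : 0 ≤ C) (h : ∀ x, ‖Φ (ρ x)‖ ≤ C * ‖Φ x‖) :
    ∃ S : E →L[ℂ] E, ‖S‖ ≤ C ∧ ∀ x, S (Φ x) = Φ (ρ x) := by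
  let M := (LinearMap.range Φ).topologicalClosure
  have hM : CompleteSpace M := (Submodule.isClosed_topologicalClosure _).completeSpace_coe
  let e : X →ₗ[ℂ] M := Φ.codRestrict M fun x =>
    Submodule.le_topologicalClosure _ (LinearMap.mem_range_self Φ x)
  have he : DenseRange e := by
    intro y
    rw [Topology.IsInducing.subtypeVal.closure_eq_preimage_closure_image]
    have h1 : ((↑) '' Set.range e : Set E) = Set.range Φ := by
      rw [← Set.range_comp]; rfl
    rw [Set.mem_preimage]
    exact (congrArg (fun s : Set E => (y : E) ∈ closure s) h1).mpr y.2
  have hn : ∀ x, ‖(Φ ∘ₗ ρ) x‖ ≤ C * ‖e x‖ := h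
  -- Extension by continuity to the closure of the range and by `0` on its orthogonal complement.
  refine ⟨((Φ ∘ₗ ρ).extendOfNorm e) ∘L M.orthogonalProjectionOnto, ?_, fun x => ?_⟩
  · refine (ContinuousLinearMap.opNorm_comp_le _ _).trans ?_
    exact (mul_le_of_le_one_right (norm_nonneg _) M.orthogonalProjectionOnto_norm_le).trans
      (LinearMap.opNorm_extendOfNorm_le he hC hn)
  · have h2 : M.orthogonalProjectionOnto (Φ x) = e x :=
      M.orthogonalProjectionOnto_mem_subspace_eq_self (e x)
    rw [ContinuousLinearMap.comp_apply, h2, LinearMap.extendOfNorm_eq he ⟨C, hn⟩]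
    rfl

/-- The vector `k` placed at `g o` has branch sum `Z ^ d(o, g o) k` at the root. `K` is in `Type` so
that `ℓ²(V, K)` stays in the universe of the group. -/
lemma isContractiveCoefficient_of_dist {V : Type u} {T : SimpleGraph V} [T.LocallyFinite]
    (hT : T.IsTree) {K : Type} [NormedAddCommGroup K] [InnerProductSpace ℂ K] [CompleteSpace K]
    (Z : K →L[ℂ] K) {A B c : ℝ} (hA : 0 < A) (hB : 1 ≤ B)
    (hAB : ∀ a b : K, ‖a‖ ^ 2 + A * ‖b + Z a‖ ^ 2 ≤ A * ‖a + Z b‖ ^ 2 + B * ‖b‖ ^ 2)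
    (d : ℕ) (o : V) {k k' : K} (hk : B ^ d * ‖k‖ ^ 2 ≤ c) (hk' : ‖k'‖ ^ 2 ≤ c) :
    IsContractiveCoefficient d c fun g : T ≃g T => inner ℂ k' ((Z ^ T.dist o (g o)) k) := by
  classical
  have hA' : 0 < √A := Real.sqrt_pos.2 hA
  have hB' : 0 < √B := Real.sqrt_pos.2 (by linarith)
  have hBC : (√B : ℂ) ≠ 0 := by exact_mod_cast hB'.ne'
  set κ : ℂ := ((√A : ℝ) : ℂ) with hκ
  have hκ0 : κ ≠ 0 := by rw [hκ]; exact_mod_cast hA'.ne'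
  have hκA : ‖κ‖ ^ 2 = A := by
    rw [hκ, Complex.norm_real, Real.norm_of_nonneg hA'.le, Real.sq_sqrt hA.le]
  let Φ := SimpleGraph.branchMap hT.connected Z κ o
  -- The energy of `g f` at `g o` equals that of `f` at `o`; passing from the root `g o` to `o`
  -- costs the factor `B`.
  have hΦ : ∀ (g : T ≃g T) f, ‖Φ (Finsupp.lmapDomain K ℂ g f)‖ ≤ √B * ‖Φ f‖ := by
    intro g f
    rw [← sq_le_sq₀ (norm_nonneg _) (by positivity), mul_pow, Real.sq_sqrt (by linarith),
      SimpleGraph.norm_branchMap_sq, SimpleGraph.norm_branchMap_sq, hκA, Finsupp.lmapDomain_apply,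
      ← SimpleGraph.branchEnergy_mapDomain hT.connected Z A g o f]
    exact hT.branchEnergy_le Z hA.le hB hAB _ _ _
  choose S hS hSΦ using fun g : T ≃g T => Φ.exists_clm_of_norm_le _ hB'.le (hΦ g)
  have hprod : ∀ (l : List (T ≃g T)) (x : V) (k : K),
      (l.map fun g => (√B : ℂ)⁻¹ • S g).prod (Φ (Finsupp.single x k)) =
        (√B : ℂ)⁻¹ ^ l.length • Φ (Finsupp.single (l.prod x) k) := by
    intro l x k
    induction l with
    | nil => simp
    | cons g l ih =>
      rw [List.map_cons, List.prod_cons, mul_apply_eq_comp, ih, map_smul,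
        smul_apply, hSΦ, Finsupp.lmapDomain_apply, Finsupp.mapDomain_single,
        List.prod_cons, List.length_cons, pow_succ, mul_smul]
      rfl
  -- The factor `√B ^ d` undoes the normalisation of `d` contractions, and `κ⁻¹` cancels the weight
  -- at the root.
  refine ⟨lp (fun _ : V => K) 2, inferInstance, inferInstance, inferInstance,
    fun g => (√B : ℂ)⁻¹ • S g, (√B : ℂ) ^ d • Φ (Finsupp.single o (κ⁻¹ • k)), lp.single 2 o k',
    fun g => ?_, ?_, ?_, fun t => ?_⟩
  · rw [norm_smul, norm_inv, Complex.norm_real, Real.norm_of_nonneg hB'.le, inv_mul_le_iff₀ hB',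
      mul_one]
    exact hS g
  · rw [SimpleGraph.branchMap_single_root, smul_inv_smul₀ hκ0, norm_smul,
      lp.norm_single (by norm_num), norm_pow, Complex.norm_real, Real.norm_of_nonneg hB'.le,
      mul_pow, ← pow_mul, mul_comm d, pow_mul, Real.sq_sqrt (by linarith)]
    exact hk
  · rw [lp.norm_single (by norm_num)]
    exact hk'
  · have h1 := hprod ((List.range d).map t) o (κ⁻¹ • k)
    rw [List.map_map, List.length_map, List.length_range] at h1
    rw [map_smul]
    refine Eq.trans ?_ (congrArg (fun z => inner ℂ (lp.single 2 o k') ((√B : ℂ) ^ d • z)) h1).symm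
    dsimp only
    rw [smul_smul, ← mul_pow, mul_inv_cancel₀ hBC, one_pow, one_smul, lp.inner_single_left,
      SimpleGraph.branchMap_apply, if_pos rfl, SimpleGraph.branchSum_single, if_pos (by simp),
      map_smul, smul_inv_smul₀ hκ0]

/-- Since `a = (a + Z b) - Z b`, the left side is bounded by squares of `a + Z b` and `b`. Only the
first coefficient is constrained; `B` absorbs the other. -/
lemma exists_energy_constants {K : Type*} [NormedAddCommGroup K] [NormedSpace ℂ K]
    (Z : K →L[ℂ] K) {ρ : ℝ} (hρ0 : 0 ≤ ρ) (hρ : ρ < 1) (hZ : ‖Z‖ ≤ ρ) :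
    ∃ A B : ℝ, 0 < A ∧ 1 ≤ B ∧
      ∀ a b : K, ‖a‖ ^ 2 + A * ‖b + Z a‖ ^ 2 ≤ A * ‖a + Z b‖ ^ 2 + B * ‖b‖ ^ 2 := by
  have hδ : 0 < 1 - ρ := by linarith
  -- Then `1 + A ρ = A - 2`, which leaves room for the factor `1 + (1 - ρ) / 2` in `h6`.
  set A : ℝ := 3 / (1 - ρ) with hA
  have hA0 : 0 < A := by positivity
  have hAδ : A * (1 - ρ) = 3 := by rw [hA]; field_simp
  refine ⟨A, 1 + (1 + A * ρ) * (1 + 2 / (1 - ρ)) + A / (1 - ρ), hA0, ?_, fun a b => ?_⟩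
  · have : 0 ≤ (1 + A * ρ) * (1 + 2 / (1 - ρ)) + A / (1 - ρ) := by positivity
    linarith
  have h1 : ‖a‖ ≤ ‖a + Z b‖ + ρ * ‖b‖ := by
    have := norm_sub_le (a + Z b) (Z b)
    rw [add_sub_cancel_right] at this
    exact this.trans (add_le_add le_rfl (Z.le_of_opNorm_le hZ b))
  have h2 : ‖b + Z a‖ ≤ ‖b‖ + ρ * ‖a‖ :=
    (norm_add_le _ _).trans (add_le_add le_rfl (Z.le_of_opNorm_le hZ a))
  set α := ‖a‖
  set x := ‖a + Z b‖
  set y := ‖b‖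
  have hα : 0 ≤ α := norm_nonneg _
  have hx : 0 ≤ x := norm_nonneg _
  have hy : 0 ≤ y := norm_nonneg _
  have h3 : ‖b + Z a‖ ^ 2 ≤ ρ * α ^ 2 + y ^ 2 / (1 - ρ) := by
    refine (pow_le_pow_left₀ (norm_nonneg _) h2 2).trans ?_
    have h : ρ * α ^ 2 + y ^ 2 / (1 - ρ) - (y + ρ * α) ^ 2 =
        ρ / (1 - ρ) * ((1 - ρ) * α - y) ^ 2 := by
      field_simp; ring
    have : 0 ≤ ρ / (1 - ρ) * ((1 - ρ) * α - y) ^ 2 := by positivity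
    linarith
  have h4 : α ^ 2 ≤ (1 + (1 - ρ) / 2) * x ^ 2 + (1 + 2 / (1 - ρ)) * y ^ 2 := by
    have h5 : α ≤ x + y := h1.trans (by nlinarith)
    refine (pow_le_pow_left₀ hα h5 2).trans ?_
    have h : (1 + (1 - ρ) / 2) * x ^ 2 + (1 + 2 / (1 - ρ)) * y ^ 2 - (x + y) ^ 2 =
        2 / (1 - ρ) * ((1 - ρ) / 2 * x - y) ^ 2 := by
      field_simp; ring
    have : 0 ≤ 2 / (1 - ρ) * ((1 - ρ) / 2 * x - y) ^ 2 := by positivity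
    linarith
  have h6 : (1 + A * ρ) * (1 + (1 - ρ) / 2) ≤ A := by nlinarith
  calc α ^ 2 + A * ‖b + Z a‖ ^ 2 ≤ α ^ 2 + A * (ρ * α ^ 2 + y ^ 2 / (1 - ρ)) := by gcongr
    _ = (1 + A * ρ) * α ^ 2 + A / (1 - ρ) * y ^ 2 := by ring
    _ ≤ (1 + A * ρ) * ((1 + (1 - ρ) / 2) * x ^ 2 + (1 + 2 / (1 - ρ)) * y ^ 2) +
          A / (1 - ρ) * y ^ 2 := by gcongr
    _ = (1 + A * ρ) * (1 + (1 - ρ) / 2) * x ^ 2 +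
          ((1 + A * ρ) * (1 + 2 / (1 - ρ)) + A / (1 - ρ)) * y ^ 2 := by ring
    _ ≤ A * x ^ 2 + (1 + (1 + A * ρ) * (1 + 2 / (1 - ρ)) + A / (1 - ρ)) * y ^ 2 := by
      gcongr
      linarith

lemma SimpleGraph.continuous_comp_apply {V : Type u} {T : SimpleGraph V} {X : Type*}
    [TopologicalSpace X] (f : V → X) (o : V) :
    Continuous fun g : T ≃g T => f (g o) := by
  refine continuous_def.2 fun U _ => ?_
  have : (fun g : T ≃g T => f (g o)) ⁻¹' U = ⋃ w ∈ f ⁻¹' U, {g : T ≃g T | g o = w} := by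
    ext g
    simp
  rw [this]
  exact isOpen_biUnion fun w _ => isOpen_apply_eq o w

/-! ### Haagerup's functions and their truncations. -/

section Radial

variable {V : Type u} {T : SimpleGraph V} [T.LocallyFinite]

/-- Haagerup's functions `r ^ d(o, g o)` are coefficients of unitary representations. -/
lemma isContractiveCoefficient_pow_dist (hT : T.IsTree) (d : ℕ) (o : V) {r : ℝ} (hr0 : 0 ≤ r)
    (hr : r < 1) :
    IsContractiveCoefficient d 1 fun g : T ≃g T => (r : ℂ) ^ T.dist o (g o) := by
  have hr2 : 0 < 1 - r ^ 2 := by nlinarith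
  -- For this `A` the energy inequality with `B = 1` is an equality, so the action is isometric.
  have key := isContractiveCoefficient_of_dist hT ((r : ℂ) • ContinuousLinearMap.id ℂ ℂ)
    (A := 1 / (1 - r ^ 2)) (B := 1) (c := 1) (by positivity) le_rfl (fun a b => ?_) d o
    (k := 1) (k' := 1) (by simp) (by simp)
  · convert key using 2 with g
    have h : ∀ n : ℕ, (((r : ℂ) • ContinuousLinearMap.id ℂ ℂ) ^ n) (1 : ℂ) = (r : ℂ) ^ n := by
      intro n
      induction n with
      | zero => simp
      | succ n ih => rw [pow_succ', mul_apply_eq_comp, ih, pow_succ']; simp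
    rw [h]
    simp
  · simp only [Complex.sq_norm, Complex.normSq_apply, smul_apply, ContinuousLinearMap.id_apply,
      smul_eq_mul, Complex.add_re, Complex.add_im, Complex.re_ofReal_mul, Complex.im_ofReal_mul]
    refine le_of_eq ?_
    field_simp
    ring

/-- The unilateral shift on `ℓ²(ℕ)`. -/
lemma exists_shift : ∃ S : lp (fun _ : ℕ => ℂ) 2 →L[ℂ] lp (fun _ : ℕ => ℂ) 2, ‖S‖ ≤ 1 ∧
    ∀ n, S (lp.single 2 n 1) = lp.single 2 (n + 1) 1 := by
  let v : ℕ → lp (fun _ : ℕ => ℂ) 2 := fun n => lp.single 2 (n + 1) 1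
  have hv : Orthonormal ℂ v := by
    rw [orthonormal_iff_ite]
    intro i j
    rw [lp.inner_single_left, lp.single_apply]
    by_cases h : i = j
    · subst h; simp
    · rw [if_neg h, Pi.single_eq_of_ne (by omega)]; simp
  refine ⟨hv.orthogonalFamily.linearIsometry.toContinuousLinearMap,
    LinearIsometry.norm_toContinuousLinearMap_le _, fun n => ?_⟩
  refine (hv.orthogonalFamily.linearIsometry_apply_single (1 : ℂ)).trans ?_
  simp [v]

lemma exists_tail {ρ : ℝ} (hρ0 : 0 ≤ ρ) (hρ : ρ < 1) {ε : ℝ} (hε : 0 < ε) (m : ℕ) :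
    ∃ N, m ≤ N ∧ ∃ x : lp (fun _ : ℕ => ℂ) 2, ‖x‖ ^ 2 ≤ ε ∧
      ∀ n, x n = if n ≤ N then 0 else (ρ : ℂ) ^ n := by
  have hlim : Filter.Tendsto (fun N : ℕ => ρ ^ N * (1 - ρ)⁻¹) Filter.atTop (𝓝 0) := by
    simpa using (tendsto_pow_atTop_nhds_zero_of_lt_one hρ0 hρ).mul_const (1 - ρ)⁻¹
  obtain ⟨N, hN, hmN⟩ :=
    ((hlim.eventually (gt_mem_nhds hε)).and (Filter.eventually_ge_atTop m)).exists
  have hs : Summable fun n => ρ ^ N * ρ ^ n :=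
    (summable_geometric_of_lt_one hρ0 hρ).mul_left _
  let f : ℕ → ℂ := fun n => if n ≤ N then 0 else (ρ : ℂ) ^ n
  have hf : ∀ n, ‖f n‖ ^ 2 ≤ ρ ^ N * ρ ^ n := by
    intro n
    by_cases h : n ≤ N
    · simp only [f, if_pos h, norm_zero]
      rw [zero_pow two_ne_zero]
      positivity
    · simp only [f, if_neg h, norm_pow, Complex.norm_real, Real.norm_of_nonneg hρ0]
      rw [sq]
      have := pow_le_pow_of_le_one hρ0 hρ.le (not_le.1 h).le
      gcongr
  have hsf : Summable fun n => ‖f n‖ ^ 2 :=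
    Summable.of_nonneg_of_le (fun n => by positivity) hf hs
  have hmem : Memℓp f 2 := memℓp_gen (by simpa using hsf)
  refine ⟨N, hmN, ⟨f, hmem⟩, ?_, fun n => rfl⟩
  have := lp.norm_rpow_eq_tsum (p := 2) (by simp) (⟨f, hmem⟩ : lp (fun _ : ℕ => ℂ) 2)
  simp only [ENNReal.toReal_ofNat, Real.rpow_ofNat] at this
  rw [this]
  refine (hsf.tsum_le_tsum hf hs).trans ?_
  rw [tsum_mul_left, tsum_geometric_of_lt_one hρ0 hρ]
  exact hN.le

/-- The part of `r ^ d(o, g o)` that is supported far from the stabiliser of `o` is small. -/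
lemma exists_isContractiveCoefficient_tail (hT : T.IsTree) (d : ℕ) (o : V) {r : ℝ} (hr0 : 0 ≤ r)
    (hr : r < 1) {ε : ℝ} (hε : 0 < ε) (m : ℕ) :
    ∃ N, m ≤ N ∧ IsContractiveCoefficient d ε
      fun g : T ≃g T => if T.dist o (g o) ≤ N then 0 else -(r : ℂ) ^ T.dist o (g o) := by
  -- In `r ^ n = ρ ^ n * ρ ^ n`, one factor makes `Z` a strict contraction and the other makes the
  -- vector `x` square-summable.
  set ρ := √r
  have hρ0 : 0 ≤ ρ := Real.sqrt_nonneg r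
  have hρ : ρ < 1 := by rw [Real.sqrt_lt' one_pos]; simpa using hr
  have hρr : (ρ : ℂ) * ρ = r := by exact_mod_cast Real.mul_self_sqrt hr0
  obtain ⟨S, hS, hSn⟩ := exists_shift
  let Z := (ρ : ℂ) • S
  have hZ : ‖Z‖ ≤ ρ := by
    rw [norm_smul, Complex.norm_real, Real.norm_of_nonneg hρ0]
    exact mul_le_of_le_one_right hρ0 hS
  have hZn : ∀ n, (Z ^ n) (lp.single 2 0 1) = (ρ : ℂ) ^ n • lp.single 2 n 1 := by
    intro n
    induction n with
    | zero => simp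
    | succ n ih =>
      rw [pow_succ', mul_apply_eq_comp, ih, map_smul, smul_apply, hSn, smul_smul,
        pow_succ]
  obtain ⟨A, B, hA, hB, hAB⟩ := exists_energy_constants Z hρ0 hρ hZ
  have hBd : 0 < B ^ d := by positivity
  set s : ℝ := √(ε / B ^ d)
  have hs0 : 0 < s := Real.sqrt_pos.2 (by positivity)
  have hs2 : s ^ 2 = ε / B ^ d := Real.sq_sqrt (by positivity)
  have hsC : (s : ℂ) ≠ 0 := by exact_mod_cast hs0.ne'
  -- `B` depends only on `r`, so `N` can be chosen last. The scale `s` balances the vectors: `B ^ d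
  -- * ‖k‖ ^ 2 = ε` and `‖k'‖ ^ 2 ≤ ε`.
  obtain ⟨N, hmN, x, hx, hxn⟩ := exists_tail hρ0 hρ (show 0 < ε * s ^ 2 by positivity) m
  refine ⟨N, hmN, ?_⟩
  have key := isContractiveCoefficient_of_dist hT Z (c := ε) hA hB hAB d o
    (k := (s : ℂ) • lp.single 2 0 1) (k' := -(s : ℂ)⁻¹ • x) ?_ ?_
  · convert key using 2 with g
    rw [map_smul, hZn, inner_smul_right, inner_smul_right, inner_smul_left,
      lp.inner_single_right, hxn]
    split_ifs with h
    · simp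
    · simp only [map_neg, map_inv₀, Complex.conj_ofReal, map_pow, RCLike.inner_apply, one_mul]
      rw [← hρr, mul_pow]
      field_simp
  · rw [norm_smul, lp.norm_single (by norm_num), norm_one, mul_one, Complex.norm_real,
      Real.norm_of_nonneg hs0.le, hs2]
    exact (mul_div_cancel₀ _ hBd.ne').le
  · rw [norm_smul, norm_neg, norm_inv, Complex.norm_real, Real.norm_of_nonneg hs0.le, mul_pow,
      inv_pow, inv_mul_le_iff₀ (by positivity), mul_comm]
    exact hx

lemma exists_isContractiveCoefficient_truncated (hT : T.IsTree) (d : ℕ) (o : V) {r : ℝ}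
    (hr0 : 0 ≤ r) (hr : r < 1) {ε : ℝ} (hε : 0 < ε) (m : ℕ) :
    ∃ N, m ≤ N ∧ IsContractiveCoefficient d (1 + ε)
      fun g : T ≃g T => if T.dist o (g o) ≤ N then (r : ℂ) ^ T.dist o (g o) else 0 := by
  obtain ⟨N, hN, h⟩ := exists_isContractiveCoefficient_tail hT d o hr0 hr hε m
  refine ⟨N, hN, ?_⟩
  convert (isContractiveCoefficient_pow_dist hT d o hr0 hr).add h using 1
  ext g
  simp only [Pi.add_apply]
  split_ifs <;> simp

/-- Balls are finite, so this is a finite union of cosets of the compact stabiliser of `o`. -/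
lemma SimpleGraph.isCompact_setOf_dist_le (hT : T.Connected) (o : V) (N : ℕ) :
    IsCompact {g : T ≃g T | T.dist o (g o) ≤ N} := by
  have hw : ∀ w, IsCompact {g : T ≃g T | g o = w} := by
    intro w
    by_cases h : ∃ g₀ : T ≃g T, g₀ o = w
    · obtain ⟨g₀, rfl⟩ := h
      convert (isCompact_stabilizer hT o).image (continuous_const_mul g₀) using 1
      ext g
      simp only [Set.mem_image, Set.mem_ofPred_eq]
      refine ⟨fun hg => ⟨g₀⁻¹ * g, ?_, by group⟩, ?_⟩
      · rw [RelIso.mul_apply, hg, RelIso.inv_apply_self]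
      · rintro ⟨h, hh, rfl⟩
        rw [RelIso.mul_apply, hh]
    · convert isCompact_empty
      ext g
      simp only [Set.mem_ofPred_eq, Set.mem_empty_iff_false, iff_false]
      exact fun hg => h ⟨g, hg⟩
  have hfin : {w | T.dist o w ≤ N}.Finite := by
    refine ((Set.finite_Iic N).biUnion fun n _ => finite_walk_length (T := T) o n).subset ?_
    intro w hw
    obtain ⟨p, hp⟩ := hT.exists_walk_length_eq_dist o w
    exact Set.mem_biUnion (x := p.length) (by rw [Set.mem_Iic, hp]; exact hw) ⟨p, rfl⟩
  convert hfin.isCompact_biUnion fun w _ => hw w using 1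
  ext g
  simp

lemma exists_mdMultiplier_truncated (hT : T.IsTree) {d : ℕ} (hd : 1 ≤ d) (o : V) {r : ℝ}
    (hr0 : 0 ≤ r) (hr : r < 1) {ε : ℝ} (hε : 0 < ε) (m : ℕ) :
    ∃ φ : MdMultiplier (T ≃g T) d, φ.mdNorm ≤ 1 ∧ HasCompactSupport φ ∧
      ∀ g : T ≃g T, T.dist o (g o) ≤ m → φ g = (1 + ε : ℂ)⁻¹ * (r : ℂ) ^ T.dist o (g o) := by
  obtain ⟨N, hmN, hcoef⟩ := exists_isContractiveCoefficient_truncated hT d o hr0 hr hε m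
  obtain ⟨D, hD, hDb⟩ := hcoef.exists_factorization hd
  have hn : ‖(1 + ε : ℂ)⁻¹‖ = (1 + ε)⁻¹ := by
    rw [norm_inv, ← Complex.ofReal_one, ← Complex.ofReal_add, Complex.norm_real,
      Real.norm_of_nonneg (by positivity)]
  have hE := hD.smul hd (1 + ε : ℂ)⁻¹
  have hEb : (D.smul (1 + ε : ℂ)⁻¹).bound ≤ 1 := by
    rw [MdFactorization.bound_smul hd, hn, inv_mul_le_iff₀ (by positivity), mul_one]
    exact hDb
  let φ : MdMultiplier (T ≃g T) d := ⟨BoundedContinuousFunction.ofNormedAddCommGroup _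
    (SimpleGraph.continuous_comp_apply (fun w => (1 + ε : ℂ)⁻¹ *
      if T.dist o w ≤ N then (r : ℂ) ^ T.dist o w else 0) o) _ (hE.norm_le hd), _, hE⟩
  refine ⟨φ, (φ.mdNorm_le hE).trans hEb, ?_, fun g hg => ?_⟩
  · refine HasCompactSupport.intro (SimpleGraph.isCompact_setOf_dist_le hT.connected o N)
      fun g hg => ?_
    change (1 + ε : ℂ)⁻¹ * (if T.dist o (g o) ≤ N then (r : ℂ) ^ T.dist o (g o) else 0) = 0
    rw [if_neg (show ¬ T.dist o (g o) ≤ N from hg), mul_zero]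
  · change (1 + ε : ℂ)⁻¹ * (if T.dist o (g o) ≤ N then (r : ℂ) ^ T.dist o (g o) else 0) = _
    rw [if_pos (hg.trans hmN)]

end Radial

/-! ### Passage to the limit `r → 1`. -/

lemma oneMemMdClosure_aut {V : Type u} (T : SimpleGraph V) [T.LocallyFinite] (hT : T.IsTree)
    (d : ℕ) [d.AtLeastTwo] [LocallyCompactSpace (T ≃g T)] : OneMemMdClosure (T ≃g T) d 1 := by
  obtain ⟨o⟩ := hT.connected.nonempty
  -- One parameter for both limits: `r = 1 - δ n` and `ε = δ n`, with truncation radius at least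
  -- `n`.
  let δ : ℕ → ℝ := fun n => 1 / ((n : ℝ) + 1)
  have hδ0 : ∀ n, 0 < δ n := fun n => by positivity
  have hδ1 : ∀ n, δ n ≤ 1 := fun n => by
    rw [div_le_one (by positivity)]
    linarith [n.cast_nonneg (α := ℝ)]
  have hδ : Filter.Tendsto δ Filter.atTop (𝓝 0) := tendsto_one_div_add_atTop_nhds_zero_nat
  choose φ hφ hc hval using fun n : ℕ => exists_mdMultiplier_truncated hT
    (one_le_of_atLeastTwo d) o (sub_nonneg.2 (hδ1 n)) (sub_lt_self 1 (hδ0 n)) (hδ0 n) n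
  refine oneMemMdClosure_one_of_tendsto hφ hc fun g => ?_
  have hlim : Filter.Tendsto
      (fun n => (1 + δ n : ℂ)⁻¹ * ((1 - δ n : ℝ) : ℂ) ^ T.dist o (g o)) Filter.atTop (𝓝 1) := by
    have hδC : Filter.Tendsto (fun n => (δ n : ℂ)) Filter.atTop (𝓝 0) := by
      exact_mod_cast (Complex.continuous_ofReal.tendsto 0).comp hδ
    have h1 := (hδC.const_add 1).inv₀ (by simp)
    have h2 := (hδC.const_sub 1).pow (T.dist o (g o))
    simpa using h1.mul h2
  refine hlim.congr' ?_
  filter_upwards [Filter.eventually_ge_atTop (T.dist o (g o))] with n hn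
  exact (hval n g hn).symm

theorem corollary4p5 {V : Type u} (T : SimpleGraph V) [T.LocallyFinite] (hT : T.IsTree)
    (d : ℕ) [d.AtLeastTwo] :
    haveI : LocallyCompactSpace (T ≃g T) := hT.locallyCompactSpace_aut
    IsMdWeaklyAmenable (T ≃g T) d ∧ mdConstant (T ≃g T) d = 1 := by
  have : LocallyCompactSpace (T ≃g T) := hT.locallyCompactSpace_aut
  have h := oneMemMdClosure_aut T hT d
  exact ⟨⟨1, le_rfl, h⟩, mdConstant_eq_one h⟩
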